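/- For integers $n\ge 1$ let $\mathcal D_n=\{(b,\dots,b)\}\subset\mathbb C^n$, let $\eta\colon\mathbb C^n\smallsetminus\mathcal D_n\to P(n)$ be the projection to the quotient by the action $Z\mapsto aZ+(b,\dots,b)$ ($a\in\mathbb C\smallsetminus\{0\}$, $b\in\mathbb C$) of the complex affine group, let $\mathbb L(n)\subset\mathbb C^n\smallsetminus\mathcal D_n$ be the set of $Z=(z_1,\dots,z_n)$ with $z_1,\dots,z_n$ collinear, let $\mu\colon P(n)\to P(n)$ be induced by $(z_1,z_2,\dots,z_n)\mapsto(z_2,\dots,z_n,z_1)$, and let $\mathscr L(n)=\eta(\mathbb L(n))/\langle\mu\rangle$ (so $\mathscr L(1)=\emptyset$ and $\mathscr L(2)$ is a point). Let $\mathcal R_n\in GL_{n-1}(\mathbb R)$ be the block diagonal matrix whose blocks are the rotation matrices of angles $m\cdot\frac{2\pi}{n}$, $1\le m\le\lfloor\frac{n-1}{2}\rfloor$ in increasing order, followed by a last entry $-1$ if $n$ is even. Let $\nu(X)=-X$, let $\mathbb S^{n-2}\subset\mathbb R^{n-1}$ be the unit sphere, and for $j\in\mathbb N$ put $$\ell^j(n)=\{X\in\mathbb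 S^{n-2}\colon \mathcal R_n^jX=X\ \text{or}\ \mathcal R_n^jX=-X\}.$$ For integers $q\ge1$ and $p_1,\dots,p_m$ with $\gcd(p_1,\dots,p_m,q)=1$, let $L_q(p_1,\dots,p_m)=\mathbb S^{2m-1}/\langle G\rangle$, where $\mathbb S^{2m-1}\subset\mathbb C^m$ is the unit sphere and $G(z_1,\dots,z_m)=(e^{2\pi i p_1/q}z_1,\dots,e^{2\pi i p_m/q}z_m)$ (for $m=0$ this space is empty). Let $\mathcal C_A=A\times[0,1]/(A\times\{1\})$ denote the closed cone over a space $A$, the cone over the empty space being one point. All quotients carry the quotient topology, and $\sqcup$ is the topological disjoint union. **Theorem.** Let $n\ge 3$, let $j$ be a positive divisor of $n$ with $j<n$, and let $k=n/j$. Then the quotient $\ell^j(n)/\langle\mathcal R_n,\nu\rangle$ is homeomorphic to: 1. $\mathscr L(j)$, if $k$ is odd; 2. $\mathscr L(j)\sqcup L_{2j}(1,3,5,\dots,j-1)$, if $k$ and $j$ are even; 3. $\mathscr L(j)\sqcup\big(\mathcal C_{L_j(1,3,\dots,j-2)}/\{([X],0)\sim([-X],0)\}\big)$, if $k$ is even and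 $j$ is odd, where $[X]\mapsto[-X]$ is the map of $L_j(1,3,\dots,j-2)$ induced by the antipodal map of the sphere $\mathbb S^{j-2}\subset\mathbb C^{(j-1)/2}$ (for $j=1$ the list of weights is empty, $L_1()=\emptyset$, and the second summand is one point). -/

import Mathlib

namespace NSegment

/-- The orbit space `S / Γ` of a (`Γ`-invariant) subset `S` of a space with an action of a group,
with the quotient of the subspace topology: two points of `S` are identified if and only if
they lie in the same `Γ`-orbit. -/
abbrev OrbitSpace {G X : Type*} [Group G] [MulAction G X] (Γ : Subgroup G) (S : Set X) : Type _ :=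
  Quotient ((MulAction.orbitRel Γ X).comap (Subtype.val : S → X))

section Shapes

/-- `ℂⁿ ∖ 𝒟ₙ`: the `n`-gons whose vertices do not all coincide. -/
abbrev Polygon (n : ℕ) : Type := {Z : Fin n → ℂ // ¬ ∃ b : ℂ, ∀ i, Z i = b}

/-- Equivalence under the complex affine group: `W = a Z + (b, …, b)` with `a ≠ 0`. -/
def affineSetoid (n : ℕ) : Setoid (Polygon n) where
  r Z W := ∃ a b : ℂ, a ≠ 0 ∧ ∀ i, W.1 i = a * Z.1 i + b
  iseqv :=
    { refl := fun Z => ⟨1, 0, one_ne_zero, fun i => by simp⟩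
      symm := by
        rintro Z W ⟨a, b, ha, h⟩
        refine ⟨a⁻¹, -(a⁻¹ * b), inv_ne_zero ha, fun i => ?_⟩
        rw [h i]
        field_simp
        ring
      trans := by
        rintro Z W V ⟨a, b, ha, h⟩ ⟨c, d, hc, h'⟩
        refine ⟨c * a, c * b + d, mul_ne_zero hc ha, fun i => ?_⟩
        rw [h' i, h i]
        ring }

/-- The space `P(n)` of shapes of `n`-gons with labelled vertices. -/
abbrev ShapeSpace (n : ℕ) : Type := Quotient (affineSetoid n)

/-- The natural projection `η : ℂⁿ ∖ 𝒟ₙ → P(n)`. -/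
def shape (n : ℕ) (Z : Polygon n) : ShapeSpace n := Quotient.mk (affineSetoid n) Z

/-- The (nondegenerate) `n`-segments: `n`-gons with collinear vertices. -/
def segments (n : ℕ) : Set (Polygon n) := {Z | Collinear ℝ (Set.range Z.1)}

/-- The cyclic relabelling `M (z₁, z₂, …, zₙ) = (z₂, …, zₙ, z₁)`. -/
def relabel (n : ℕ) : Equiv.Perm (Polygon n) where
  toFun Z := ⟨fun i => Z.1 (finRotate n i), fun ⟨b, hb⟩ =>
    Z.2 ⟨b, fun i => by
      have h : Z.1 (finRotate n ((finRotate n).symm i)) = b := hb ((finRotate n).symm i)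
      rwa [Equiv.apply_symm_apply] at h⟩⟩
  invFun Z := ⟨fun i => Z.1 ((finRotate n).symm i), fun ⟨b, hb⟩ =>
    Z.2 ⟨b, fun i => by
      have h : Z.1 ((finRotate n).symm (finRotate n i)) = b := hb (finRotate n i)
      rwa [Equiv.symm_apply_apply] at h⟩⟩
  left_inv Z := Subtype.ext (funext fun i => congrArg Z.1 ((finRotate n).apply_symm_apply i))
  right_inv Z := Subtype.ext (funext fun i => congrArg Z.1 ((finRotate n).symm_apply_apply i))

/-- The map `μ : P(n) → P(n)` with `μ ∘ η = η ∘ M`. -/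
def shapeRelabel (n : ℕ) : Equiv.Perm (ShapeSpace n) :=
  Quotient.congr (relabel n) fun Z W => by
    constructor
    · rintro ⟨a, b, ha, h⟩
      exact ⟨a, b, ha, fun i => h _⟩
    · rintro ⟨a, b, ha, h⟩
      exact ⟨a, b, ha, fun i => by
        have h' := h ((finRotate n).symm i)
        simp only [relabel, Equiv.coe_fn_mk, Equiv.apply_symm_apply] at h'
        exact h'⟩

/-- `ℒ(n) = η(𝕃(n)) / ⟨μ⟩`: the shapes of `n`-segments without labelled vertices. -/
abbrev UnlabelledShapes (n : ℕ) : Type :=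
  OrbitSpace (Subgroup.zpowers (shapeRelabel n)) (shape n '' segments n)

end Shapes

section Rotation

/-- The block matrix `𝓡ₙ` of size `n - 1`. The rows and columns `2m` and `2m + 1` (counted from `0`)
form the block given by the rotation matrix of angle `(m + 1) · 2π/n`. For even `n` the last row
`n - 2` is alone in its block, and the entry there is `cos π = -1`. -/
noncomputable def rotMatrix (n : ℕ) : Matrix (Fin (n - 1)) (Fin (n - 1)) ℝ := fun i l =>
  if i.1 / 2 = l.1 / 2 then
    if i = l then Real.cos ((i.1 / 2 + 1 : ℕ) * (2 * Real.pi / n))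
    else if i < l then -Real.sin ((i.1 / 2 + 1 : ℕ) * (2 * Real.pi / n))
    else Real.sin ((i.1 / 2 + 1 : ℕ) * (2 * Real.pi / n))
  else 0

theorem rotMatrix_mul_transpose (n : ℕ) : rotMatrix n * (rotMatrix n).transpose = 1 := by
  ext i l
  rw [Matrix.mul_apply, Matrix.one_apply]
  simp only [Matrix.transpose_apply]
  have hi := i.2
  have hl := l.2
  by_cases hb : i.1 / 2 = l.1 / 2
  · by_cases hp : 2 * (i.1 / 2) + 1 < n - 1
    · have hlt : 2 * (i.1 / 2) < n - 1 := by omega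
      rw [Fintype.sum_eq_add (⟨2 * (i.1 / 2), hlt⟩ : Fin (n - 1)) ⟨2 * (i.1 / 2) + 1, hp⟩]
      · have e1 : 2 * (i.1 / 2) / 2 = i.1 / 2 := by omega
        have e2 : (2 * (i.1 / 2) + 1) / 2 = i.1 / 2 := by omega
        have hcs := Real.sin_sq_add_cos_sq ((i.1 / 2 + 1 : ℕ) * (2 * Real.pi / n))
        simp only [rotMatrix, e1, e2, ← hb, if_true, Fin.ext_iff, Fin.lt_def]
        rcases Nat.mod_two_eq_zero_or_one i.1 with h | h <;>
        rcases Nat.mod_two_eq_zero_or_one l.1 with h' | h'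
        · have hi' : i.1 = 2 * (i.1 / 2) := by omega
          have hl' : l.1 = i.1 := by omega
          have c1 : i.1 ≠ 2 * (i.1 / 2) + 1 := by omega
          have c2 : i.1 < 2 * (i.1 / 2) + 1 := by omega
          simp only [hl', if_pos hi', if_neg c1, if_pos c2, if_true]
          linear_combination hcs
        · have hi' : i.1 = 2 * (i.1 / 2) := by omega
          have hl' : l.1 = 2 * (i.1 / 2) + 1 := by omega
          have c0 : i.1 ≠ l.1 := by omega
          have c1 : i.1 ≠ 2 * (i.1 / 2) + 1 := by omega
          have c2 : i.1 < 2 * (i.1 / 2) + 1 := by omega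
          have c3 : l.1 ≠ 2 * (i.1 / 2) := by omega
          have c4 : ¬ l.1 < 2 * (i.1 / 2) := by omega
          simp only [if_pos hi', if_pos hl', if_neg c0, if_neg c1, if_pos c2, if_neg c3, if_neg c4]
          ring
        · have hi' : i.1 = 2 * (i.1 / 2) + 1 := by omega
          have hl' : l.1 = 2 * (i.1 / 2) := by omega
          have c0 : i.1 ≠ l.1 := by omega
          have c1 : l.1 ≠ 2 * (i.1 / 2) + 1 := by omega
          have c2 : l.1 < 2 * (i.1 / 2) + 1 := by omega
          have c3 : i.1 ≠ 2 * (i.1 / 2) := by omega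
          have c4 : ¬ i.1 < 2 * (i.1 / 2) := by omega
          simp only [if_pos hi', if_pos hl', if_neg c0, if_neg c1, if_pos c2, if_neg c3, if_neg c4]
          ring
        · have hi' : i.1 = 2 * (i.1 / 2) + 1 := by omega
          have hl' : l.1 = i.1 := by omega
          have c3 : i.1 ≠ 2 * (i.1 / 2) := by omega
          have c4 : ¬ i.1 < 2 * (i.1 / 2) := by omega
          simp only [hl', if_pos hi', if_neg c3, if_neg c4, if_true]
          linear_combination hcs
      · simp [Fin.ext_iff]
      · rintro x ⟨h1, h2⟩
        have : ¬ i.1 / 2 = x.1 / 2 := by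
          simp only [ne_eq, Fin.ext_iff] at h1 h2
          omega
        simp [rotMatrix, this]
    · have hil : i = l := by
        apply Fin.ext
        omega
      subst hil
      rw [Fintype.sum_eq_single i]
      · have hn : ((i.1 / 2 + 1 : ℕ) : ℝ) * 2 = n := by
          have : (i.1 / 2 + 1) * 2 = n := by omega
          exact_mod_cast this
        have hn0 : (n : ℝ) ≠ 0 := by
          have : n ≠ 0 := by omega
          exact_mod_cast this
        have ha : ((i.1 / 2 + 1 : ℕ) : ℝ) * (2 * Real.pi / n) = Real.pi := by
          field_simp
          exact hn
        simp [rotMatrix, -Nat.cast_add, ha]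
      · intro x hx
        have : ¬ i.1 / 2 = x.1 / 2 := by
          simp only [ne_eq, Fin.ext_iff] at hx
          have := x.2
          omega
        simp [rotMatrix, this]
  · rw [if_neg (by rintro rfl; exact hb rfl)]
    apply Finset.sum_eq_zero
    intro x _
    by_cases hx : i.1 / 2 = x.1 / 2
    · have : ¬ l.1 / 2 = x.1 / 2 := by omega
      simp [rotMatrix, this]
    · simp [rotMatrix, hx]

/-- `𝓡ₙ` as a linear automorphism of `ℝⁿ⁻¹`. -/
noncomputable def rot (n : ℕ) :
    EuclideanSpace ℝ (Fin (n - 1)) ≃ₗ[ℝ] EuclideanSpace ℝ (Fin (n - 1)) :=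
  LinearEquiv.ofLinearMap (Matrix.toEuclideanLin (rotMatrix n))
    (Matrix.toEuclideanLin (rotMatrix n).transpose)
    (by rw [← Matrix.toLpLin_mul, rotMatrix_mul_transpose, Matrix.toLpLin_one])
    (by rw [← Matrix.toLpLin_mul, mul_eq_one_comm.mp (rotMatrix_mul_transpose n),
      Matrix.toLpLin_one])

/-- The group `⟨𝓡ₙ, ν⟩` of linear automorphisms of `ℝⁿ⁻¹`, where `ν(X) = -X`. -/
noncomputable def rotGroup (n : ℕ) :
    Subgroup (EuclideanSpace ℝ (Fin (n - 1)) ≃ₗ[ℝ] EuclideanSpace ℝ (Fin (n - 1))) :=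
  Subgroup.closure {rot n, LinearEquiv.neg ℝ}

/-- `ℓʲ(n)`: the points `X` of the unit sphere of `ℝⁿ⁻¹` with `𝓡ₙʲ X = X` or `𝓡ₙʲ X = -X`. -/
def fixedLocus (j n : ℕ) : Set (EuclideanSpace ℝ (Fin (n - 1))) :=
  {X | X ∈ Metric.sphere 0 1 ∧ ((rot n ^ j) X = X ∨ (rot n ^ j) X = -X)}

end Rotation

section Lens

/-- The map `G (z₁, …, zₘ) = (e^{2πi p₁/q} z₁, …, e^{2πi pₘ/q} zₘ)` of `ℂᵐ`. -/
noncomputable def lensMap {m : ℕ} (q : ℕ) (p : Fin m → ℤ) :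
    EuclideanSpace ℂ (Fin m) ≃ₗ[ℂ] EuclideanSpace ℂ (Fin m) where
  toFun z := WithLp.toLp 2 fun t => Complex.exp (2 * Real.pi * Complex.I * (p t / q)) * z t
  invFun z := WithLp.toLp 2 fun t => Complex.exp (-(2 * Real.pi * Complex.I * (p t / q))) * z t
  map_add' z w := by ext t; simp [mul_add]
  map_smul' c z := by ext t; simp; ring
  left_inv z := by ext t; simp [← mul_assoc, ← Complex.exp_add]
  right_inv z := by ext t; simp [← mul_assoc, ← Complex.exp_add]

/-- The orbifold lens space `L_q(p₁, …, pₘ) = 𝕊²ᵐ⁻¹ / ⟨G⟩`, for `q ≥ 1` and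
`gcd (p₁, …, pₘ, q) = 1`. -/
abbrev LensSpace {m : ℕ} (q : ℕ) (p : Fin m → ℤ) : Type :=
  OrbitSpace (Subgroup.zpowers (lensMap q p)) (Metric.sphere (0 : EuclideanSpace ℂ (Fin m)) 1)

/-- The map `[X] ↦ [-X]` of a lens space. -/
noncomputable def lensNeg {m : ℕ} (q : ℕ) (p : Fin m → ℤ) : LensSpace q p → LensSpace q p :=
  Quotient.map (fun X => -X) (by
    rintro X Y ⟨⟨g, hg⟩, h⟩
    refine ⟨⟨g, hg⟩, ?_⟩
    have h' : g Y.1 = X.1 := h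
    change g (-Y.1) = -X.1
    rw [map_neg, h'])

/-- The weights `(1, 3, …, 2m - 1)`. -/
def oddWeights (m : ℕ) : Fin m → ℤ := fun t => 2 * (t.1 : ℤ) + 1

end Lens

section Cone

/-- The relation that collapses `A × {1}` to the apex. -/
inductive ConeRel (A : Type*) : (A × unitInterval) ⊕ Unit → (A × unitInterval) ⊕ Unit → Prop
  | apex (a : A) : ConeRel A (Sum.inl (a, 1)) (Sum.inr ())

/-- The closed cone `A × [0, 1] / (A × {1})`. The apex is added as a separate point before
`A × {1}` is collapsed to it, which makes no difference unless `A` is empty;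
the cone over the empty space is one point. -/
abbrev Cone (A : Type*) [TopologicalSpace A] : Type _ := Quot (ConeRel A)

/-- The point `[a, s]` of the cone. -/
def Cone.mk {A : Type*} [TopologicalSpace A] (a : A) (s : unitInterval) : Cone A :=
  Quot.mk _ (Sum.inl (a, s))

/-- The relation that identifies each point `[a, 0]` of the base of the cone with `[τ a, 0]`. -/
inductive BaseRel {A : Type*} [TopologicalSpace A] (τ : A → A) : Cone A → Cone A → Prop
  | base (a : A) : BaseRel τ (Cone.mk a 0) (Cone.mk (τ a) 0)

/-- The cone over `A` with `[a, 0] ∼ [τ a, 0]` on its base. -/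
abbrev ConeModBase {A : Type*} [TopologicalSpace A] (τ : A → A) : Type _ := Quot (BaseRel τ)

end Cone

end NSegment

open Topology

namespace NSegment


/-! The solutions of `𝓡ₙʲ X = X` and of `𝓡ₙʲ X = -X` on the sphere are disjoint, closed and
invariant, so the quotient is a disjoint sum (`orbitSpace_fixedLocus_homeomorph`). Each summand is
identified by comparing the fibres of two quotient maps with the same source.

Fixed summand: grouping real coordinates in pairs turns `𝓡ₙ` into multiplication by `ζ^(m+1)` on
block `m`. Summing the real parts of the blocks along the orbit of `X` gives a real `n`-tuple.
Fourier orthogonality and a dimension count show that every real tuple arises exactly once, up to a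
constant. Vectors fixed by `𝓡ₙʲ` give the `j`-periodic tuples, hence `j`-segments; `𝓡ₙ` becomes the
cyclic relabelling, and on the unit sphere equality of shapes means equality up to sign. This yields
`ℒ(j)` (`orbitSpace_fixedPart_homeomorph`).

Negated summand: it is empty for odd `k`. If `k = 2c`, only the blocks with `m + 1 = c(2t+1)`
survive, and there `𝓡ₙ` rotates by `2π(2t+1)/(2j)`. For even `j` these blocks are all complex planes
and `ν` acts as `𝓡ₙʲ`, which leaves the lens space with `q = 2j`. For odd `j` there is one more real
coordinate, negated by `𝓡ₙ`; the group then acts as `⟨𝓡ₙ², ν⟩`. Modulo `ν` only the upper hemisphere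
is needed, which is a cone over its equator; `𝓡ₙ²` preserves heights and produces the cone over the
lens space with `q = j`, while `ν` still identifies antipodes on the equator. -/

theorem nonempty_homeomorph_of_isQuotientMap {X Y Z : Type*} [TopologicalSpace X]
    [TopologicalSpace Y] [TopologicalSpace Z] {f : X → Y} {g : X → Z} (hf : IsQuotientMap f)
    (hg : IsQuotientMap g) (h : ∀ x y, f x = f y ↔ g x = g y) : Nonempty (Y ≃ₜ Z) := by
  have e : Setoid.ker f = Setoid.ker g := Setoid.ext fun x y => h x y
  have hf' := IsQuotientMap.homeomorph (f := ⟨f, hf.continuous⟩) hf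
  change Quotient (Setoid.ker f) ≃ₜ Y at hf'
  rw [e] at hf'
  exact ⟨hf'.symm.trans (IsQuotientMap.homeomorph (f := ⟨g, hg.continuous⟩) hg)⟩

theorem nonempty_homeomorph_of_injective {X Y : Type*} [TopologicalSpace X]
    [TopologicalSpace Y] {f : X → Y} (hf : IsQuotientMap f) (h : Function.Injective f) :
    Nonempty (X ≃ₜ Y) :=
  nonempty_homeomorph_of_isQuotientMap IsQuotientMap.id hf fun _ _ => h.eq_iff.symm

theorem isQuotientMap_sumMap {X Y Z W : Type*} [TopologicalSpace X] [TopologicalSpace Y]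
    [TopologicalSpace Z] [TopologicalSpace W] {f : X → Y} {g : Z → W} (hf : IsQuotientMap f)
    (hg : IsQuotientMap g) : IsQuotientMap (Sum.map f g) := by
  refine isQuotientMap_iff_isClosed.2 ⟨hf.surjective.sumMap hg.surjective, fun s => ?_⟩
  rw [isClosed_sum_iff, isClosed_sum_iff, ← hf.isClosed_preimage, ← hg.isClosed_preimage]
  rfl

/-! ### Orbit spaces and their quotient maps -/

section OrbitSpace

variable {G X : Type*} [Group G] [MulAction G X] (Γ : Subgroup G)

/-- The class of a point of `S` in the orbit space. -/
def OrbitSpace.mk {S : Set X} (x : S) : OrbitSpace Γ S := Quotient.mk _ x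

theorem OrbitSpace.mk_eq_mk {S : Set X} {x y : S} :
    OrbitSpace.mk Γ x = OrbitSpace.mk Γ y ↔ ∃ g ∈ Γ, g • (y : X) = x := by
  refine Quotient.eq.trans ?_
  change (∃ g : Γ, g • (y : X) = x) ↔ _
  simp [Subgroup.smul_def]

variable [TopologicalSpace X]

theorem OrbitSpace.isQuotientMap_mk (S : Set X) :
    IsQuotientMap (OrbitSpace.mk Γ : S → OrbitSpace Γ S) :=
  isQuotientMap_quot_mk

/-- The saturation of an open set is the union of its preimages under the group elements. Openness
is what makes the product with `[0, 1]` a quotient map again, as the cone requires. -/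
theorem OrbitSpace.isOpenMap_mk {S : Set X} (hc : ∀ g ∈ Γ, Continuous fun x : X => g • x)
    (hS : ∀ g ∈ Γ, ∀ x ∈ S, g • x ∈ S) : IsOpenMap (OrbitSpace.mk Γ : S → OrbitSpace Γ S) := by
  intro U hU
  rw [← (OrbitSpace.isQuotientMap_mk Γ S).isOpen_preimage]
  have : OrbitSpace.mk Γ ⁻¹' (OrbitSpace.mk Γ '' U) =
      ⋃ g : Γ, (fun x : S => (⟨g.1 • x.1, hS g.1 g.2 x.1 x.2⟩ : S)) ⁻¹' U := by
    ext x
    simp only [Set.mem_preimage, Set.mem_image, Set.mem_iUnion, OrbitSpace.mk_eq_mk]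
    constructor
    · rintro ⟨u, hu, g, hg, h⟩
      refine ⟨⟨g, hg⟩, ?_⟩
      convert hu
    · rintro ⟨g, hg⟩
      exact ⟨_, hg, g.1, g.2, rfl⟩
  rw [this]
  exact isOpen_iUnion fun g =>
    hU.preimage (((hc g.1 g.2).comp continuous_subtype_val).subtype_mk _)

/-- An orbit space splits along a decomposition into disjoint closed invariant subsets. -/
theorem OrbitSpace.nonempty_homeomorph_sum {S A B : Set X} (hS : S = A ∪ B) (hA : IsClosed A)
    (hB : IsClosed B) (hAB : Disjoint A B) (hinv : ∀ g ∈ Γ, ∀ x ∈ A, g • x ∈ A) :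
    Nonempty (OrbitSpace Γ S ≃ₜ OrbitSpace Γ A ⊕ OrbitSpace Γ B) := by
  have hAS : A ⊆ S := hS ▸ Set.subset_union_left
  have hBS : B ⊆ S := hS ▸ Set.subset_union_right
  let f : A ⊕ B → S := Sum.elim (Set.inclusion hAS) (Set.inclusion hBS)
  have hf : IsQuotientMap f := by
    refine IsClosedMap.isQuotientMap ?_ ?_ ?_
    · exact (hA.isClosedMap_inclusion hAS).sumElim (hB.isClosedMap_inclusion hBS)
    · exact (continuous_inclusion hAS).sumElim (continuous_inclusion hBS)
    · rintro ⟨x, hx⟩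
      rcases hS ▸ hx with h | h
      · exact ⟨Sum.inl ⟨x, h⟩, rfl⟩
      · exact ⟨Sum.inr ⟨x, h⟩, rfl⟩
  have hg : IsQuotientMap (Sum.map (OrbitSpace.mk Γ : A → _) (OrbitSpace.mk Γ : B → _)) := by
    exact isQuotientMap_sumMap (OrbitSpace.isQuotientMap_mk Γ A) (OrbitSpace.isQuotientMap_mk Γ B)
  refine nonempty_homeomorph_of_isQuotientMap ((OrbitSpace.isQuotientMap_mk Γ S).comp hf) hg ?_
  -- Invariance of `A` suffices: an element carrying a point of `B` into `A` has an inverse excluded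
  -- here.
  have hcross : ∀ (a : A) (b : B), ∀ g ∈ Γ, g • (a : X) ≠ b := fun a b g hg h =>
    Set.disjoint_left.1 hAB (hinv g hg a.1 a.2) (h ▸ b.2)
  rintro (x | x) (y | y)
  · simp [f, OrbitSpace.mk_eq_mk]
  · simp only [Function.comp, f, Sum.elim_inl, Sum.elim_inr, OrbitSpace.mk_eq_mk, Sum.map_inl,
      Sum.map_inr, reduceCtorEq, iff_false, not_exists, not_and]
    intro g hg h
    refine hcross x y g⁻¹ (inv_mem hg) ?_
    rw [inv_smul_eq_iff]
    exact h.symm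
  · simp only [Function.comp, f, Sum.elim_inl, Sum.elim_inr, OrbitSpace.mk_eq_mk, Sum.map_inl,
      Sum.map_inr, reduceCtorEq, iff_false, not_exists, not_and]
    intro g hg h
    exact hcross y x g hg h
  · simp [f, OrbitSpace.mk_eq_mk]

end OrbitSpace

/-- A map that intertwines `g` and `h` on an invariant set intertwines their integral powers. -/
theorem zpow_smul_semiconj {G H X Y : Type*} [Group G] [Group H] [MulAction G X] [MulAction H Y]
    {g : G} {h : H} {f : X → Y} {S : Set X} (hS : ∀ x, g • x ∈ S ↔ x ∈ S)
    (hf : ∀ x ∈ S, f (g • x) = h • f x) (i : ℤ) :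
    ∀ x ∈ S, g ^ i • x ∈ S ∧ f (g ^ i • x) = h ^ i • f x := by
  induction i using Int.induction_on with
  | zero => intro x hx; simpa using hx
  | succ i ih =>
    intro x hx
    obtain ⟨h1, h2⟩ := ih x hx
    rw [add_comm, zpow_add, zpow_one, mul_smul, hf _ h1, h2, zpow_add, zpow_one, mul_smul]
    exact ⟨(hS _).2 h1, rfl⟩
  | pred i ih =>
    intro x hx
    obtain ⟨h1, h2⟩ := ih x hx
    have e : g • g ^ (-(i : ℤ) - 1) • x = g ^ (-(i : ℤ)) • x := by
      rw [smul_smul, ← zpow_one_add]; congr 2; ring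
    have e' : h • h ^ (-(i : ℤ) - 1) • f x = h ^ (-(i : ℤ)) • f x := by
      rw [smul_smul, ← zpow_one_add]; congr 2; ring
    have h3 : g ^ (-(i : ℤ) - 1) • x ∈ S := by
      rw [← hS, e]; exact h1
    refine ⟨h3, ?_⟩
    apply MulAction.injective h
    change h • _ = h • _
    rw [← hf _ h3, e, e', h2]


/-! ### Complex block coordinates that diagonalize `𝓡ₙ` -/

section Coordinates

/-- The coordinates of a vector, extended by zero. -/
noncomputable def extCoord {N : ℕ} (X : EuclideanSpace ℝ (Fin N)) (i : ℕ) : ℝ :=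
  if h : i < N then X ⟨i, h⟩ else 0

/-- The complex coordinate of `X` in the block `m` (counted from `0`) of `𝓡ₙ`. -/
noncomputable def coord {N : ℕ} (m : ℕ) (X : EuclideanSpace ℝ (Fin N)) : ℂ :=
  ⟨extCoord X (2 * m), extCoord X (2 * m + 1)⟩

/-- The primitive `n`-th root of unity `e^{2πi/n}`. -/
noncomputable def zeta (n : ℕ) : ℂ := Complex.exp (2 * Real.pi * Complex.I / n)

theorem zeta_isPrimitiveRoot {n : ℕ} (hn : n ≠ 0) : IsPrimitiveRoot (zeta n) n :=
  Complex.isPrimitiveRoot_exp n hn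

theorem norm_zeta (n : ℕ) : ‖zeta n‖ = 1 := by
  have : 2 * Real.pi * Complex.I / n = ((2 * Real.pi / n : ℝ) : ℂ) * Complex.I := by
    push_cast; ring
  rw [zeta, this, Complex.norm_exp_ofReal_mul_I]

theorem sum_range_two_mul (f : ℕ → ℝ) (N : ℕ) :
    ∑ i ∈ Finset.range (2 * N), f i = ∑ m ∈ Finset.range N, (f (2 * m) + f (2 * m + 1)) := by
  induction N with
  | zero => simp
  | succ N ih =>
    rw [Finset.sum_range_succ, ← ih, show 2 * (N + 1) = 2 * N + 1 + 1 by ring,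
      Finset.sum_range_succ, Finset.sum_range_succ, add_assoc]

/-- The `n / 2` blocks contain exactly `n - 1` indices for odd `n`, and one superfluous index for
even `n > 0`, where `f` vanishes. -/
theorem sum_fin_eq_sum_blocks {n : ℕ} (f : ℕ → ℝ) (hf : ∀ i, n - 1 ≤ i → f i = 0) :
    ∑ i : Fin (n - 1), f i = ∑ m ∈ Finset.range (n / 2), (f (2 * m) + f (2 * m + 1)) := by
  rw [← sum_range_two_mul, Fin.sum_univ_eq_sum_range]
  apply Finset.sum_subset
  · intro i; simp only [Finset.mem_range]; omega
  · intro i _ hi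
    apply hf
    simpa using hi

theorem extCoord_of_le {N : ℕ} (X : EuclideanSpace ℝ (Fin N)) {i : ℕ} (h : N ≤ i) :
    extCoord X i = 0 := dif_neg (by omega)

theorem extCoord_fin {N : ℕ} (X : EuclideanSpace ℝ (Fin N)) (i : Fin N) :
    extCoord X i = X i := dif_pos i.2

theorem coord_ext {n : ℕ} {X Y : EuclideanSpace ℝ (Fin (n - 1))}
    (h : ∀ m < n / 2, coord m X = coord m Y) : X = Y := by
  ext i
  have hm := h (i.1 / 2) (by omega)
  rw [Complex.ext_iff] at hm
  simp only [coord] at hm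
  rw [← extCoord_fin, ← extCoord_fin]
  rcases Nat.mod_two_eq_zero_or_one i.1 with h0 | h0
  · rw [show i.1 = 2 * (i.1 / 2) by omega]; exact hm.1
  · rw [show i.1 = 2 * (i.1 / 2) + 1 by omega]; exact hm.2

theorem norm_sq_eq_sum_coord {n : ℕ} (X : EuclideanSpace ℝ (Fin (n - 1))) :
    ‖X‖ ^ 2 = ∑ m ∈ Finset.range (n / 2), ‖coord m X‖ ^ 2 := by
  rw [EuclideanSpace.norm_sq_eq]
  have := sum_fin_eq_sum_blocks (n := n) (fun i => extCoord X i ^ 2)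
    (fun i hi => by simp [extCoord_of_le X hi])
  simp only [extCoord_fin] at this
  simp only [Real.norm_eq_abs, sq_abs, this]
  refine Finset.sum_congr rfl fun m _ => ?_
  rw [← Complex.normSq_eq_norm_sq, Complex.normSq_apply, coord]
  ring

theorem extCoord_add {N : ℕ} (X Y : EuclideanSpace ℝ (Fin N)) (i : ℕ) :
    extCoord (X + Y) i = extCoord X i + extCoord Y i := by
  unfold extCoord; split <;> simp

theorem extCoord_smul {N : ℕ} (a : ℝ) (X : EuclideanSpace ℝ (Fin N)) (i : ℕ) :
    extCoord (a • X) i = a * extCoord X i := by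
  unfold extCoord; split <;> simp

theorem coord_add {N : ℕ} (m : ℕ) (X Y : EuclideanSpace ℝ (Fin N)) :
    coord m (X + Y) = coord m X + coord m Y := by
  apply Complex.ext <;> simp [coord, extCoord_add]

theorem coord_smul {N : ℕ} (m : ℕ) (a : ℝ) (X : EuclideanSpace ℝ (Fin N)) :
    coord m (a • X) = a * coord m X := by
  apply Complex.ext <;> simp [coord, extCoord_smul]

theorem coord_neg {N : ℕ} (m : ℕ) (X : EuclideanSpace ℝ (Fin N)) :
    coord m (-X) = -coord m X := by
  rw [← neg_one_smul ℝ, coord_smul]; simp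

/-- For even `n` the last block is a single entry; extension by zero makes it a complex coordinate
confined to the real line. -/
theorem coord_im_of_last {n m : ℕ} (hm : 2 * m + 2 = n) (X : EuclideanSpace ℝ (Fin (n - 1))) :
    (coord m X).im = 0 := extCoord_of_le X (by omega)

/-- The vector with prescribed complex coordinates. -/
noncomputable def ofCoord (n : ℕ) (d : ℕ → ℂ) : EuclideanSpace ℝ (Fin (n - 1)) :=
  WithLp.toLp 2 fun i => if i.1 % 2 = 0 then (d (i.1 / 2)).re else (d (i.1 / 2)).im

theorem coord_ofCoord {n m : ℕ} {d : ℕ → ℂ} (hm : m < n / 2)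
    (hd : 2 * m + 2 = n → (d m).im = 0) : coord m (ofCoord n d) = d m := by
  apply Complex.ext
  · simp only [coord, extCoord, ofCoord]
    rw [dif_pos (by omega)]
    simp
  · simp only [coord, extCoord, ofCoord]
    split_ifs with h1 h2
    · omega
    · rw [show (2 * m + 1) / 2 = m by omega]
    · rw [hd (by omega)]

theorem extCoord_rot {n : ℕ} (X : EuclideanSpace ℝ (Fin (n - 1))) {i : ℕ} (hi : i < n - 1) :
    extCoord (rot n X) i =
      (if i = 2 * (i / 2) then Real.cos ((i / 2 + 1 : ℕ) * (2 * Real.pi / n))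
        else Real.sin ((i / 2 + 1 : ℕ) * (2 * Real.pi / n))) * extCoord X (2 * (i / 2)) +
      (if i = 2 * (i / 2) then -Real.sin ((i / 2 + 1 : ℕ) * (2 * Real.pi / n))
        else Real.cos ((i / 2 + 1 : ℕ) * (2 * Real.pi / n))) * extCoord X (2 * (i / 2) + 1) := by
  have h1 : extCoord (rot n X) i = ∑ l : Fin (n - 1), rotMatrix n ⟨i, hi⟩ l * X l := by
    rw [extCoord, dif_pos hi]
    rfl
  have h2 := sum_fin_eq_sum_blocks (n := n) (fun l => (if i / 2 = l / 2 then
    if i = l then Real.cos ((i / 2 + 1 : ℕ) * (2 * Real.pi / n))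
    else if i < l then -Real.sin ((i / 2 + 1 : ℕ) * (2 * Real.pi / n))
    else Real.sin ((i / 2 + 1 : ℕ) * (2 * Real.pi / n))
    else 0) * extCoord X l) (fun l hl => by simp only [extCoord_of_le X hl, mul_zero])
  simp only [extCoord_fin] at h2
  rw [h1]
  simp only [rotMatrix, Fin.ext_iff, Fin.lt_def]
  rw [h2, Finset.sum_eq_single (i / 2)]
  · have e1 : i / 2 = 2 * (i / 2) / 2 := by omega
    have e2 : i / 2 = (2 * (i / 2) + 1) / 2 := by omega
    rw [if_pos e1, if_pos e2]
    rcases Nat.mod_two_eq_zero_or_one i with h | h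
    · have a1 : i = 2 * (i / 2) := by omega
      have a2 : ¬ i = 2 * (i / 2) + 1 := by omega
      have a3 : i < 2 * (i / 2) + 1 := by omega
      rw [if_pos a1, if_neg a2, if_pos a3, if_pos a1, if_pos a1]
    · have a1 : ¬ i = 2 * (i / 2) := by omega
      have a2 : i = 2 * (i / 2) + 1 := by omega
      have a3 : ¬ i < 2 * (i / 2) := by omega
      rw [if_neg a1, if_pos a2, if_neg a3, if_neg a1, if_neg a1]
  · intro m _ hm
    have e1 : ¬ i / 2 = 2 * m / 2 := by omega
    have e2 : ¬ i / 2 = (2 * m + 1) / 2 := by omega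
    rw [if_neg e1, if_neg e2]; simp
  · intro h
    simp only [Finset.mem_range] at h
    omega

theorem zeta_pow_eq {n : ℕ} (m : ℕ) : zeta n ^ m =
    ⟨Real.cos (m * (2 * Real.pi / n)), Real.sin (m * (2 * Real.pi / n))⟩ := by
  rw [zeta, ← Complex.exp_nat_mul]
  have : (m : ℂ) * (2 * Real.pi * Complex.I / n) =
      ((m * (2 * Real.pi / n) : ℝ) : ℂ) * Complex.I := by push_cast; ring
  rw [this]
  apply Complex.ext
  · rw [Complex.exp_ofReal_mul_I_re]
  · rw [Complex.exp_ofReal_mul_I_im]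

/-- A rotation block is multiplication by a unit complex number, and the lone entry `-1` fits the
same formula. -/
theorem coord_rot {n : ℕ} (m : ℕ) (X : EuclideanSpace ℝ (Fin (n - 1))) :
    coord m (rot n X) = zeta n ^ (m + 1) * coord m X := by
  rw [zeta_pow_eq]
  by_cases h0 : 2 * m < n - 1
  · have r0 := extCoord_rot X h0
    rw [show 2 * m / 2 = m by omega, if_pos rfl, if_pos rfl] at r0
    apply Complex.ext
    · simp only [coord, Complex.mul_re]
      rw [r0]; ring
    · simp only [coord, Complex.mul_im]
      by_cases h1 : 2 * m + 1 < n - 1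
      · have r1 := extCoord_rot X h1
        rw [show (2 * m + 1) / 2 = m by omega, if_neg (by omega), if_neg (by omega)] at r1
        rw [r1]; ring
      · rw [extCoord_of_le _ (not_lt.1 h1), extCoord_of_le _ (not_lt.1 h1)]
        -- In the one-entry block the angle is `π`, so the sine vanishes and the imaginary part
        -- stays zero.
        have hn : (n : ℝ) = 2 * ((m + 1 : ℕ) : ℝ) := by
          have : n = 2 * (m + 1) := by omega
          rw [this]; push_cast; ring
        have : ((m + 1 : ℕ) : ℝ) * (2 * Real.pi / n) = Real.pi := by
          rw [hn]
          have : ((m + 1 : ℕ) : ℝ) ≠ 0 := by positivity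
          field_simp
        rw [this]; simp
  · have e0 : ∀ Y : EuclideanSpace ℝ (Fin (n - 1)), coord m Y = 0 := fun Y => by
      apply Complex.ext
      · exact extCoord_of_le Y (by omega)
      · exact extCoord_of_le Y (by omega)
    rw [e0, e0, mul_zero]

theorem coord_rot_pow {n : ℕ} (m i : ℕ) (X : EuclideanSpace ℝ (Fin (n - 1))) :
    coord m ((rot n ^ i) X) = zeta n ^ ((m + 1) * i) * coord m X := by
  induction i with
  | zero => simp
  | succ i ih =>
    rw [pow_succ', LinearEquiv.mul_apply, coord_rot, ih, ← mul_assoc, ← pow_add]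
    ring_nf

theorem rot_pow_self {n : ℕ} (hn : n ≠ 0) : rot n ^ n = 1 := by
  ext1 X
  apply coord_ext
  intro m _
  rw [coord_rot_pow, mul_comm (m + 1), pow_mul, (zeta_isPrimitiveRoot hn).pow_eq_one]
  simp

theorem norm_rot {n : ℕ} (X : EuclideanSpace ℝ (Fin (n - 1))) : ‖rot n X‖ = ‖X‖ := by
  rw [← sq_eq_sq₀ (norm_nonneg _) (norm_nonneg _), norm_sq_eq_sum_coord, norm_sq_eq_sum_coord]
  refine Finset.sum_congr rfl fun m _ => ?_
  rw [coord_rot, norm_mul, norm_pow, norm_zeta]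
  simp

theorem norm_rot_zpow {n : ℕ} (i : ℤ) (X : EuclideanSpace ℝ (Fin (n - 1))) :
    ‖(rot n ^ i) X‖ = ‖X‖ := by
  induction i using Int.induction_on generalizing X with
  | zero => simp
  | succ i ih => rw [zpow_add, zpow_one, LinearEquiv.mul_apply, ih, norm_rot]
  | pred i ih =>
    have := ih ((rot n)⁻¹ X)
    rw [← LinearEquiv.mul_apply, ← zpow_sub_one] at this
    rw [this]
    have h2 := norm_rot ((rot n)⁻¹ X)
    rw [← LinearEquiv.mul_apply, mul_inv_cancel] at h2
    exact h2.symm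

/-- The map `ν` is a central involution, so a word in the generators collapses to a power of `𝓡ₙ`
and a sign. -/
theorem mem_rotGroup_iff {n : ℕ}
    {g : EuclideanSpace ℝ (Fin (n - 1)) ≃ₗ[ℝ] EuclideanSpace ℝ (Fin (n - 1))} :
    g ∈ rotGroup n ↔ ∃ i : ℤ, (∀ X, g X = (rot n ^ i) X) ∨ ∀ X, g X = -(rot n ^ i) X := by
  constructor
  · intro hg
    induction hg using Subgroup.closure_induction with
    | mem x hx =>
      rcases hx with rfl | rfl
      · exact ⟨1, Or.inl fun X => by simp⟩
      · exact ⟨0, Or.inr fun X => by simp⟩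
    | one => exact ⟨0, Or.inl fun X => by simp⟩
    | mul x y _ _ hx hy =>
      obtain ⟨a, ha⟩ := hx
      obtain ⟨b, hb⟩ := hy
      refine ⟨a + b, ?_⟩
      simp only [zpow_add, LinearEquiv.mul_apply]
      rcases ha with ha | ha <;> rcases hb with hb | hb <;> simp [ha, hb]
    | inv x _ hx =>
      obtain ⟨a, ha⟩ := hx
      refine ⟨-a, ?_⟩
      have key : ∀ X, x (x⁻¹ X) = X := fun X => by
        rw [← LinearEquiv.mul_apply, mul_inv_cancel]; rfl
      have key2 : ∀ X, (rot n ^ (-a)) ((rot n ^ a) X) = X := fun X => by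
        rw [← LinearEquiv.mul_apply, ← zpow_add]; simp
      rcases ha with ha | ha
      · left; intro X
        conv_rhs => rw [← key X, ha, key2]
      · right; intro X
        conv_rhs => rw [← key X, ha, map_neg, key2, neg_neg]
  · have hr : rot n ∈ rotGroup n := Subgroup.subset_closure (by simp)
    have hν : LinearEquiv.neg ℝ ∈ rotGroup n := Subgroup.subset_closure (by simp)
    rintro ⟨i, h | h⟩
    · have : g = rot n ^ i := LinearEquiv.ext h
      rw [this]; exact zpow_mem hr i
    · have : g = LinearEquiv.neg ℝ * rot n ^ i := LinearEquiv.ext fun X => by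
        rw [h, LinearEquiv.mul_apply]; simp
      rw [this]; exact mul_mem hν (zpow_mem hr i)

end Coordinates


/-! ### Discrete Fourier analysis of the readout -/

section Readout

/-- The linear form whose values along the orbit of `𝓡ₙ` are the vertices of a segment. -/
noncomputable def readout (n : ℕ) : EuclideanSpace ℝ (Fin (n - 1)) →ₗ[ℝ] ℝ where
  toFun X := ∑ m ∈ Finset.range (n / 2), (coord m X).re
  map_add' X Y := by simp [coord_add, Finset.sum_add_distrib]
  map_smul' a X := by simp [coord_smul, Finset.mul_sum]

theorem readout_apply {n : ℕ} (X : EuclideanSpace ℝ (Fin (n - 1))) :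
    readout n X = ∑ m ∈ Finset.range (n / 2), (coord m X).re := rfl

theorem sum_pow_of_pow_eq_one {n : ℕ} {x : ℂ} (hx : x ^ n = 1) :
    ∑ i ∈ Finset.range n, x ^ i = if x = 1 then (n : ℂ) else 0 := by
  split_ifs with h
  · simp [h]
  · have := geom_sum_mul x n
    rw [hx, sub_self, mul_eq_zero] at this
    exact this.resolve_right (sub_ne_zero.2 h)

theorem conj_zeta (n : ℕ) : (starRingEnd ℂ) (zeta n) = (zeta n)⁻¹ := by
  rw [Complex.inv_def, Complex.normSq_eq_norm_sq, norm_zeta]; simp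

/-- Twice the readout at time `i` is a combination of the characters `ζ^(±(m+1)i)`, none of them
trivial. Orthogonality recovers each coordinate of `X` and kills the constant. -/
theorem eq_zero_of_readout_const {n : ℕ} {X : EuclideanSpace ℝ (Fin (n - 1))} {b : ℝ}
    (h : ∀ i < n, readout n ((rot n ^ i) X) = b) : X = 0 := by
  apply coord_ext
  intro l hl
  have hn : n ≠ 0 := by omega
  have hζ := zeta_isPrimitiveRoot hn
  have hζ0 : zeta n ≠ 0 := hζ.ne_zero hn
  set ζ := zeta n with hζd
  have h0 : coord l (0 : EuclideanSpace ℝ (Fin (n - 1))) = 0 := by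
    have := coord_smul l 0 (0 : EuclideanSpace ℝ (Fin (n - 1)))
    simpa using this
  rw [h0]
  have hinv : ∀ a, (ζ⁻¹ ^ a) ^ n = 1 := fun a => by
    rw [← pow_mul, mul_comm, pow_mul, inv_pow, hζ.pow_eq_one]; simp
  have hpos : ∀ a, (ζ ^ a) ^ n = 1 := fun a => by
    rw [← pow_mul, mul_comm, pow_mul, hζ.pow_eq_one]; simp
  have hx : ∀ i < n, ∑ m ∈ Finset.range (n / 2), (coord m X * (ζ ^ (m + 1)) ^ i +
      (starRingEnd ℂ) (coord m X) * (ζ⁻¹ ^ (m + 1)) ^ i) = 2 * b := fun i hi => by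
    rw [← h i hi, readout_apply, Complex.ofReal_sum, Finset.mul_sum]
    refine Finset.sum_congr rfl fun m _ => ?_
    rw [coord_rot_pow, Complex.re_eq_add_conj, map_mul, map_pow, conj_zeta, ← hζd, pow_mul, pow_mul]
    ring
  -- Pairing with the character of exponent `-(l+1)` annihilates the constant `2b` because `0 < l +
  -- 1 < n`.
  have hs : ∑ i ∈ Finset.range n, (ζ⁻¹ ^ (l + 1)) ^ i *
      ∑ m ∈ Finset.range (n / 2), (coord m X * (ζ ^ (m + 1)) ^ i +
        (starRingEnd ℂ) (coord m X) * (ζ⁻¹ ^ (m + 1)) ^ i) = 0 := by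
    rw [Finset.sum_congr rfl fun i hi => by rw [hx i (Finset.mem_range.1 hi)], ← Finset.sum_mul,
      sum_pow_of_pow_eq_one (hinv _), if_neg, zero_mul]
    rw [inv_pow, inv_eq_one, hζ.pow_eq_one_iff_dvd]
    exact Nat.not_dvd_of_pos_of_lt (by omega) (by omega)
  simp only [Finset.mul_sum] at hs
  rw [Finset.sum_comm] at hs
  -- The exponents `l+1` and `-(l+1)` agree modulo `n` only if `2l + 2 = n`; there the conjugate
  -- term contributes equally, the coordinate being real, whence the factor `2n`.
  have ht : ∀ m ∈ Finset.range (n / 2), ∑ i ∈ Finset.range n, (ζ⁻¹ ^ (l + 1)) ^ i *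
      (coord m X * (ζ ^ (m + 1)) ^ i + (starRingEnd ℂ) (coord m X) * (ζ⁻¹ ^ (m + 1)) ^ i) =
      if m = l then (if 2 * l + 2 = n then 2 * n * coord l X else n * coord l X) else 0 := by
    intro m hm
    have hm := Finset.mem_range.1 hm
    have e1 : ∑ i ∈ Finset.range n, (ζ⁻¹ ^ (l + 1) * ζ ^ (m + 1)) ^ i =
        if m = l then (n : ℂ) else 0 := by
      rw [sum_pow_of_pow_eq_one (by rw [mul_pow, hinv, hpos, one_mul])]
      refine if_congr ?_ rfl rfl
      rw [inv_pow, inv_mul_eq_one₀ (pow_ne_zero _ hζ0)]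
      constructor
      · intro h
        have := hζ.pow_inj (by omega) (by omega) h
        omega
      · rintro rfl; rfl
    have e2 : ∑ i ∈ Finset.range n, (ζ⁻¹ ^ (l + 1) * ζ⁻¹ ^ (m + 1)) ^ i =
        if m = l ∧ 2 * l + 2 = n then (n : ℂ) else 0 := by
      rw [sum_pow_of_pow_eq_one (by rw [mul_pow, hinv, hinv, one_mul])]
      refine if_congr ?_ rfl rfl
      rw [← pow_add, inv_pow, inv_eq_one, hζ.pow_eq_one_iff_dvd]
      constructor
      · intro h
        have := Nat.le_of_dvd (by omega) h
        omega
      · rintro ⟨rfl, h⟩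
        exact ⟨1, by omega⟩
    calc _ = coord m X * ∑ i ∈ Finset.range n, (ζ⁻¹ ^ (l + 1) * ζ ^ (m + 1)) ^ i +
          (starRingEnd ℂ) (coord m X) *
            ∑ i ∈ Finset.range n, (ζ⁻¹ ^ (l + 1) * ζ⁻¹ ^ (m + 1)) ^ i := by
          rw [Finset.mul_sum, Finset.mul_sum, ← Finset.sum_add_distrib]
          refine Finset.sum_congr rfl fun i _ => ?_
          rw [mul_pow, mul_pow]; ring
      _ = _ := by
          rw [e1, e2]
          by_cases hml : m = l
          · subst hml
            by_cases h2 : 2 * m + 2 = n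
            · have hc : (starRingEnd ℂ) (coord m X) = coord m X :=
                Complex.conj_eq_iff_im.2 (coord_im_of_last h2 X)
              simp only [h2, hc]; simp; ring
            · simp [h2]; ring
          · simp [hml]
  rw [Finset.sum_congr rfl ht, Finset.sum_ite_eq', if_pos (Finset.mem_range.2 hl)] at hs
  have hn' : (n : ℂ) ≠ 0 := Nat.cast_ne_zero.2 hn
  split_ifs at hs
  · simpa [hn'] using hs
  · simpa [hn'] using hs

/-- The linear map from pairs (vector, constant) to tuples is injective by the Fourier argument, and
both dimensions are `n`. -/
theorem exists_readout_eq {n : ℕ} (hn : n ≠ 0) (w : Fin n → ℝ) :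
    ∃ (X : EuclideanSpace ℝ (Fin (n - 1))) (b : ℝ),
      ∀ i : Fin n, w i = readout n ((rot n ^ i.1) X) + b := by
  let T : EuclideanSpace ℝ (Fin (n - 1)) × ℝ →ₗ[ℝ] (Fin n → ℝ) :=
    LinearMap.pi fun i => (readout n ∘ₗ (rot n ^ i.1 :
      EuclideanSpace ℝ (Fin (n - 1)) ≃ₗ[ℝ] _).toLinearMap).coprod LinearMap.id
  have hT : ∀ p i, T p i = readout n ((rot n ^ i.1) p.1) + p.2 := fun p i => rfl
  have hinj : Function.Injective T := by
    rw [injective_iff_map_eq_zero]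
    rintro ⟨X, b⟩ h
    have h' : ∀ i < n, readout n ((rot n ^ i) X) = -b := fun i hi => by
      have := congrFun h ⟨i, hi⟩
      rw [hT] at this
      simp only [Pi.zero_apply] at this
      linarith
    have hX := eq_zero_of_readout_const h'
    have h0 := h' 0 (by omega)
    subst hX
    simp only [map_zero] at h0
    simp; linarith
  have hsurj := (LinearMap.injective_iff_surjective_of_finrank_eq_finrank (f := T)
    (by simp; omega)).1 hinj
  obtain ⟨⟨X, b⟩, h⟩ := hsurj w
  exact ⟨X, b, fun i => by rw [← h, hT]⟩

theorem rot_pow_mod {n j : ℕ} {X : EuclideanSpace ℝ (Fin (n - 1))} (hX : (rot n ^ j) X = X)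
    (i : ℕ) : (rot n ^ (i % j)) X = (rot n ^ i) X := by
  have h : ∀ a, (rot n ^ (j * a)) X = X := fun a => by
    induction a with
    | zero => simp
    | succ a ih => rw [Nat.mul_succ, pow_add, LinearEquiv.mul_apply, hX, ih]
  conv_rhs => rw [← Nat.mod_add_div i j, pow_add, LinearEquiv.mul_apply, h]

/-- Every real `j`-tuple is, up to translation, read off from a vector fixed by `𝓡ₙʲ`. -/
theorem exists_fixed_readout_eq {n j : ℕ} (hn : n ≠ 0) (hj : 0 < j) (hjn : j ∣ n)
    (w : Fin j → ℝ) : ∃ (X : EuclideanSpace ℝ (Fin (n - 1))) (b : ℝ), (rot n ^ j) X = X ∧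
      ∀ i : Fin j, w i = readout n ((rot n ^ i.1) X) + b := by
  -- Extend `w` periodically to `n` entries. As `j ∣ n` and `𝓡ₙⁿ = 1`, the formula then holds for
  -- all natural `i`, and periodicity makes every readout of `𝓡ₙʲ X - X` vanish.
  obtain ⟨X, b, h⟩ := exists_readout_eq hn fun i : Fin n => w ⟨i.1 % j, Nat.mod_lt _ hj⟩
  have h' : ∀ i : ℕ, w ⟨i % j, Nat.mod_lt _ hj⟩ = readout n ((rot n ^ i) X) + b := fun i => by
    have := h ⟨i % n, Nat.mod_lt _ (Nat.pos_of_ne_zero hn)⟩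
    simp only [Nat.mod_mod_of_dvd i hjn] at this
    rw [this, rot_pow_mod (by rw [rot_pow_self hn]; rfl)]
  refine ⟨X, b, ?_, fun i => ?_⟩
  · rw [← sub_eq_zero]
    apply eq_zero_of_readout_const (b := 0)
    intro i _
    have h1 := h' (i + j)
    have h2 := h' i
    simp only [Nat.add_mod_right] at h1
    rw [map_sub, map_sub, ← LinearEquiv.mul_apply, ← pow_add]
    linarith
  · rw [← h' i]
    congr 1
    exact Fin.ext (Nat.mod_eq_of_lt i.2).symm

end Readout

/-! ### The shape space is Hausdorff -/

section Shapes

/-- An affine invariant of a polygon: it separates shapes. -/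
noncomputable def shapeInvariant (n : ℕ) (Z : Polygon n) (p : Fin n × Fin n × Fin n × Fin n) : ℂ :=
  (Z.1 p.1 - Z.1 p.2.1) * (starRingEnd ℂ) (Z.1 p.2.2.1 - Z.1 p.2.2.2) /
    ((∑ e : Fin n × Fin n, ‖Z.1 e.1 - Z.1 e.2‖ ^ 2 : ℝ) : ℂ)

theorem Polygon.exists_ne {n : ℕ} (Z : Polygon n) : ∃ c d, Z.1 c ≠ Z.1 d := by
  by_contra! h
  apply Z.2
  rcases isEmpty_or_nonempty (Fin n) with hn | ⟨⟨i⟩⟩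
  · exact ⟨0, fun i => isEmptyElim i⟩
  · exact ⟨Z.1 i, fun k => h k i⟩

theorem Polygon.sum_pos {n : ℕ} (Z : Polygon n) :
    0 < ∑ e : Fin n × Fin n, ‖Z.1 e.1 - Z.1 e.2‖ ^ 2 := by
  obtain ⟨c, d, h⟩ := Z.exists_ne
  refine Finset.sum_pos' (fun _ _ => by positivity) ⟨(c, d), Finset.mem_univ _, ?_⟩
  have : 0 < ‖Z.1 c - Z.1 d‖ := norm_pos_iff.2 (sub_ne_zero.2 h)
  positivity

theorem continuous_shapeInvariant (n : ℕ) : Continuous (shapeInvariant n) := by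
  refine continuous_pi fun p => ?_
  have hc : ∀ i : Fin n, Continuous fun Z : Polygon n => Z.1 i := fun i =>
    (continuous_apply i).comp continuous_subtype_val
  refine Continuous.div ?_ ?_ fun Z => Complex.ofReal_ne_zero.2 Z.sum_pos.ne'
  · exact ((hc _).sub (hc _)).mul (Complex.continuous_conj.comp ((hc _).sub (hc _)))
  · exact Complex.continuous_ofReal.comp
      (continuous_finsetSum _ fun e _ => (((hc _).sub (hc _)).norm).pow 2)

/-- An affine map multiplies numerator and denominator alike by `|a|²`. Conversely, the invariants
relative to one nondegenerate edge determine the polygon up to an affine map. -/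
theorem shapeInvariant_eq_iff {n : ℕ} (Z W : Polygon n) :
    shapeInvariant n Z = shapeInvariant n W ↔ affineSetoid n Z W := by
  constructor
  · intro h
    obtain ⟨c, d, hcd⟩ := Z.exists_ne
    have hZ : ((∑ e : Fin n × Fin n, ‖Z.1 e.1 - Z.1 e.2‖ ^ 2 : ℝ) : ℂ) ≠ 0 :=
      Complex.ofReal_ne_zero.2 Z.sum_pos.ne'
    have hW : ((∑ e : Fin n × Fin n, ‖W.1 e.1 - W.1 e.2‖ ^ 2 : ℝ) : ℂ) ≠ 0 :=
      Complex.ofReal_ne_zero.2 W.sum_pos.ne'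
    have hp : ∀ a b, shapeInvariant n Z (a, b, c, d) = shapeInvariant n W (a, b, c, d) :=
      fun a b => by rw [h]
    simp only [shapeInvariant] at hp
    set N := ((∑ e : Fin n × Fin n, ‖Z.1 e.1 - Z.1 e.2‖ ^ 2 : ℝ) : ℂ)
    set M := ((∑ e : Fin n × Fin n, ‖W.1 e.1 - W.1 e.2‖ ^ 2 : ℝ) : ℂ)
    have hz : (starRingEnd ℂ) (Z.1 c - Z.1 d) ≠ 0 :=
      (map_ne_zero _).2 (sub_ne_zero.2 hcd)
    -- The invariant at `(c, d, c, d)` is nonzero for `Z`, hence also for `W`.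
    have hw : (starRingEnd ℂ) (W.1 c - W.1 d) ≠ 0 := by
      intro h0
      have := hp c d
      rw [h0, mul_zero, zero_div, div_eq_zero_iff, mul_eq_zero] at this
      rcases this with (h1 | h1) | h1
      · exact sub_ne_zero.2 hcd h1
      · exact hz h1
      · exact hZ h1
    set u := (starRingEnd ℂ) (Z.1 c - Z.1 d)
    set v := (starRingEnd ℂ) (W.1 c - W.1 d)
    -- Solve `(Z i - Z d) u / N = (W i - W d) v / M` for `W i`.
    refine ⟨M / N * (u / v), W.1 d - M / N * (u / v) * Z.1 d, by positivity, fun i => ?_⟩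
    have := hp i d
    field_simp at this ⊢
    linear_combination -this
  · rintro ⟨a, b, ha, h⟩
    funext p
    simp only [shapeInvariant, h, add_sub_add_right_eq_sub, ← mul_sub, norm_mul, mul_pow,
      ← Finset.mul_sum, map_mul]
    have hZ : ((∑ e : Fin n × Fin n, ‖Z.1 e.1 - Z.1 e.2‖ ^ 2 : ℝ) : ℂ) ≠ 0 :=
      Complex.ofReal_ne_zero.2 Z.sum_pos.ne'
    have ha2 : ((‖a‖ : ℂ)) ^ 2 = a * (starRingEnd ℂ) a := by
      rw [Complex.mul_conj, Complex.normSq_eq_norm_sq]; simp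
    have hca : (starRingEnd ℂ) a ≠ 0 := by simpa using ha
    rw [Complex.ofReal_mul, Complex.ofReal_pow, ha2]
    field_simp

/-- Needed so that continuous maps from compact pieces of the sphere to shapes are closed, hence
quotient maps when surjective. -/
instance shapeSpace_t2Space (n : ℕ) : T2Space (ShapeSpace n) := by
  let f : ShapeSpace n → (Fin n × Fin n × Fin n × Fin n → ℂ) :=
    Quotient.lift (shapeInvariant n) fun Z W h => (shapeInvariant_eq_iff Z W).2 h
  refine T2Space.of_injective_continuous (f := f) ?_ ?_
  · intro x y
    induction x using Quotient.inductionOn with | _ Z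
    induction y using Quotient.inductionOn with | _ W
    exact fun h => Quotient.sound ((shapeInvariant_eq_iff Z W).1 h)
  · exact (continuous_shapeInvariant n).quotient_lift _

end Shapes


/-! ### Splitting `ℓʲ(n)` into fixed and negated vectors -/

section Parts

/-- The points of `ℓʲ(n)` that are fixed by `𝓡ₙʲ`. -/
def fixedPart (j n : ℕ) : Set (EuclideanSpace ℝ (Fin (n - 1))) :=
  {X | X ∈ Metric.sphere 0 1 ∧ (rot n ^ j) X = X}

/-- The points of `ℓʲ(n)` that are negated by `𝓡ₙʲ`. -/
def antiPart (j n : ℕ) : Set (EuclideanSpace ℝ (Fin (n - 1))) :=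
  {X | X ∈ Metric.sphere 0 1 ∧ (rot n ^ j) X = -X}

theorem continuous_rot_pow (n i : ℕ) : Continuous (rot n ^ i) :=
  (rot n ^ i).toLinearMap.continuous_of_finiteDimensional

theorem isClosed_fixedPart (j n : ℕ) : IsClosed (fixedPart j n) :=
  Metric.isClosed_sphere.inter (isClosed_eq (continuous_rot_pow n j) continuous_id)

theorem isClosed_antiPart (j n : ℕ) : IsClosed (antiPart j n) :=
  Metric.isClosed_sphere.inter (isClosed_eq (continuous_rot_pow n j) continuous_neg)

instance compactSpace_fixedPart (j n : ℕ) : CompactSpace (fixedPart j n) :=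
  isCompact_iff_compactSpace.1
    ((isCompact_sphere _ _).of_isClosed_subset (isClosed_fixedPart j n) fun _ h => h.1)

instance compactSpace_antiPart (j n : ℕ) : CompactSpace (antiPart j n) :=
  isCompact_iff_compactSpace.1
    ((isCompact_sphere _ _).of_isClosed_subset (isClosed_antiPart j n) fun _ h => h.1)

theorem rot_pow_rot_zpow {n : ℕ} (j : ℕ) (i : ℤ) (X : EuclideanSpace ℝ (Fin (n - 1))) :
    (rot n ^ j) ((rot n ^ i) X) = (rot n ^ i) ((rot n ^ j) X) := by
  rw [← LinearEquiv.mul_apply, ← LinearEquiv.mul_apply, ← zpow_natCast, ← zpow_add, ← zpow_add,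
    add_comm]

theorem rot_zpow_mem_fixedPart {n j : ℕ} (i : ℤ) {X : EuclideanSpace ℝ (Fin (n - 1))}
    (hX : X ∈ fixedPart j n) : (rot n ^ i) X ∈ fixedPart j n := by
  refine ⟨?_, ?_⟩
  · rw [mem_sphere_zero_iff_norm, norm_rot_zpow]
    exact mem_sphere_zero_iff_norm.1 hX.1
  · rw [rot_pow_rot_zpow, hX.2]

theorem rot_zpow_mem_antiPart {n j : ℕ} (i : ℤ) {X : EuclideanSpace ℝ (Fin (n - 1))}
    (hX : X ∈ antiPart j n) : (rot n ^ i) X ∈ antiPart j n := by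
  refine ⟨?_, ?_⟩
  · rw [mem_sphere_zero_iff_norm, norm_rot_zpow]
    exact mem_sphere_zero_iff_norm.1 hX.1
  · rw [rot_pow_rot_zpow, hX.2, map_neg]

theorem neg_mem_fixedPart {n j : ℕ} {X : EuclideanSpace ℝ (Fin (n - 1))}
    (hX : X ∈ fixedPart j n) : -X ∈ fixedPart j n := by
  refine ⟨?_, ?_⟩
  · rw [mem_sphere_zero_iff_norm, norm_neg]
    exact mem_sphere_zero_iff_norm.1 hX.1
  · rw [map_neg, hX.2]

theorem neg_mem_antiPart {n j : ℕ} {X : EuclideanSpace ℝ (Fin (n - 1))}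
    (hX : X ∈ antiPart j n) : -X ∈ antiPart j n := by
  refine ⟨?_, ?_⟩
  · rw [mem_sphere_zero_iff_norm, norm_neg]
    exact mem_sphere_zero_iff_norm.1 hX.1
  · rw [map_neg, hX.2]

theorem ne_zero_of_mem_sphere {E : Type*} [NormedAddCommGroup E] {X : E}
    (hX : X ∈ Metric.sphere (0 : E) 1) : X ≠ 0 := by
  rintro rfl
  simp at hX

theorem eq_zero_of_eq_neg {E : Type*} [NormedAddCommGroup E] [NormedSpace ℝ E] {X : E}
    (h : X = -X) : X = 0 := by
  have : (2 : ℝ) • X = 0 := by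
    rw [two_smul]
    nth_rewrite 1 [h]
    exact neg_add_cancel X
  exact (smul_eq_zero.1 this).resolve_left two_ne_zero

/-- The two parts are disjoint because `X = -X` fails on the sphere, and the fixed part is invariant
because `𝓡ₙʲ` commutes with the group. -/
theorem orbitSpace_fixedLocus_homeomorph (j n : ℕ) :
    Nonempty (OrbitSpace (rotGroup n) (fixedLocus j n) ≃ₜ
      OrbitSpace (rotGroup n) (fixedPart j n) ⊕ OrbitSpace (rotGroup n) (antiPart j n)) := by
  refine OrbitSpace.nonempty_homeomorph_sum _ ?_ (isClosed_fixedPart j n)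
    (isClosed_antiPart j n) ?_ ?_
  · ext X
    simp only [fixedLocus, fixedPart, antiPart, Set.mem_union, Set.mem_ofPred_eq]
    tauto
  · refine Set.disjoint_left.2 fun X h1 h2 => ne_zero_of_mem_sphere h1.1 ?_
    exact eq_zero_of_eq_neg (h1.2.symm.trans h2.2)
  · intro g hg X hX
    obtain ⟨i, h | h⟩ := mem_rotGroup_iff.1 hg
    · rw [LinearEquiv.smul_def, h]
      exact rot_zpow_mem_fixedPart i hX
    · rw [LinearEquiv.smul_def, h]
      exact neg_mem_fixedPart (rot_zpow_mem_fixedPart i hX)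

theorem orbitSpace_rotGroup_mk_eq {n : ℕ} {S : Set (EuclideanSpace ℝ (Fin (n - 1)))} {X Y : S} :
    OrbitSpace.mk (rotGroup n) X = OrbitSpace.mk (rotGroup n) Y ↔
      ∃ i : ℤ, X.1 = (rot n ^ i) Y.1 ∨ X.1 = -(rot n ^ i) Y.1 := by
  rw [OrbitSpace.mk_eq_mk]
  constructor
  · rintro ⟨g, hg, h⟩
    obtain ⟨i, hi | hi⟩ := mem_rotGroup_iff.1 hg
    · exact ⟨i, Or.inl (by rw [← hi, ← h]; rfl)⟩
    · exact ⟨i, Or.inr (by rw [← hi, ← h]; rfl)⟩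
  · rintro ⟨i, h | h⟩
    · exact ⟨rot n ^ i, mem_rotGroup_iff.2 ⟨i, Or.inl fun _ => rfl⟩, h.symm⟩
    · refine ⟨LinearEquiv.neg ℝ * rot n ^ i, mem_rotGroup_iff.2 ⟨i, Or.inr fun _ => ?_⟩, ?_⟩
      · simp
      · rw [h]; simp

end Parts

/-! ### Fixed vectors and shapes of `j`-segments -/

section FixedPart

/-- The vertices of the segment given by a vector that is fixed by `𝓡ₙʲ`. -/
noncomputable def vertices (j n : ℕ) (X : EuclideanSpace ℝ (Fin (n - 1))) (i : Fin j) : ℂ :=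
  readout n ((rot n ^ i.1) X)

theorem eq_zero_of_readout_const_of_fixed {n j : ℕ} (hj : 0 < j)
    {X : EuclideanSpace ℝ (Fin (n - 1))} (hX : (rot n ^ j) X = X) {b : ℝ}
    (h : ∀ i : Fin j, readout n ((rot n ^ i.1) X) = b) : X = 0 :=
  eq_zero_of_readout_const fun i _ => by
    rw [← rot_pow_mod hX]
    exact h ⟨i % j, Nat.mod_lt _ hj⟩

theorem vertices_not_const {n j : ℕ} (hj : 0 < j) {X : EuclideanSpace ℝ (Fin (n - 1))}
    (hX : X ∈ fixedPart j n) : ¬ ∃ b : ℂ, ∀ i, vertices j n X i = b := by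
  rintro ⟨b, hb⟩
  refine ne_zero_of_mem_sphere hX.1 (eq_zero_of_readout_const_of_fixed hj hX.2 (b := b.re) ?_)
  intro i
  rw [← hb i]; rfl

theorem collinear_vertices (j n : ℕ) (X : EuclideanSpace ℝ (Fin (n - 1))) :
    Collinear ℝ (Set.range (vertices j n X)) := by
  rw [collinear_iff_exists_forall_eq_smul_vadd]
  refine ⟨0, 1, ?_⟩
  rintro _ ⟨i, rfl⟩
  exact ⟨readout n ((rot n ^ i.1) X), by simp [vertices]⟩

/-- The segment given by a vector that is fixed by `𝓡ₙʲ`. -/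
noncomputable def fixedPolygon {j n : ℕ} (hj : 0 < j) (X : fixedPart j n) : Polygon j :=
  ⟨vertices j n X.1, vertices_not_const hj X.2⟩

/-- The shape of the segment given by a vector that is fixed by `𝓡ₙʲ`. -/
noncomputable def fixedShape {j n : ℕ} (hj : 0 < j) (X : fixedPart j n) :
    (shape j '' segments j : Set (ShapeSpace j)) :=
  ⟨shape j (fixedPolygon hj X), fixedPolygon hj X, collinear_vertices j n X.1, rfl⟩

theorem continuous_fixedShape {j n : ℕ} (hj : 0 < j) :
    Continuous (fixedShape hj : fixedPart j n → _) := by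
  refine Continuous.subtype_mk (continuous_quotient_mk'.comp (Continuous.subtype_mk ?_ _)) _
  refine continuous_pi fun i => Complex.continuous_ofReal.comp ?_
  exact (readout n).continuous_of_finiteDimensional.comp
    ((continuous_rot_pow n i).comp continuous_subtype_val)

theorem shape_eq_shape_iff {j : ℕ} (Z W : Polygon j) :
    shape j Z = shape j W ↔ ∃ a b : ℂ, a ≠ 0 ∧ ∀ i, W.1 i = a * Z.1 i + b :=
  Quotient.eq

/-- A collinear polygon is `p + wᵢ v` with real `wᵢ`, and a fixed vector realizes `w` up to
translation. Normalizing it does not change the shape. -/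
theorem surjective_fixedShape {j n : ℕ} (hn : n ≠ 0) (hj : 0 < j) (hjn : j ∣ n) :
    Function.Surjective (fixedShape hj : fixedPart j n → _) := by
  rintro ⟨_, Z, hZ, rfl⟩
  obtain ⟨p, v, h⟩ := (collinear_iff_exists_forall_eq_smul_vadd _).1 hZ
  choose w hw using fun i => h _ (Set.mem_range_self i)
  obtain ⟨X, b, hX, hr⟩ := exists_fixed_readout_eq hn hj hjn w
  simp only [vadd_eq_add, Complex.real_smul] at hw
  have hX0 : X ≠ 0 := by
    rintro rfl
    exact Z.2 ⟨b * v + p, fun i => by rw [hw, hr]; simp⟩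
  have hv : v ≠ 0 := by
    rintro rfl
    exact Z.2 ⟨p, fun i => by rw [hw]; simp⟩
  have hN : ‖X‖ ≠ 0 := norm_ne_zero_iff.2 hX0
  refine ⟨⟨‖X‖⁻¹ • X, ?_, ?_⟩, Subtype.ext ((shape_eq_shape_iff _ _).2
    ⟨‖X‖ * v, b * v + p, ?_, fun i => ?_⟩)⟩
  · rw [mem_sphere_zero_iff_norm, norm_smul, norm_inv, norm_norm, inv_mul_cancel₀ hN]
  · rw [map_smul, hX]
  · exact mul_ne_zero (Complex.ofReal_ne_zero.2 hN) hv
  · have hN' : (‖X‖ : ℂ) ≠ 0 := Complex.ofReal_ne_zero.2 hN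
    rw [hw, hr]
    simp only [fixedPolygon, vertices, map_smul, smul_eq_mul]
    push_cast
    field_simp
    ring

/-- An affine map between nonconstant real tuples has a real multiplier; injectivity of the readout
turns it into `Y = aX`, and unit norms leave `a = ±1`. -/
theorem fixedShape_eq_iff {j n : ℕ} (hj : 0 < j) (X Y : fixedPart j n) :
    fixedShape hj X = fixedShape hj Y ↔ X.1 = Y.1 ∨ X.1 = -Y.1 := by
  refine (Subtype.ext_iff.trans (shape_eq_shape_iff _ _)).trans ⟨?_, ?_⟩
  · rintro ⟨a, b, ha, h⟩
    simp only [fixedPolygon, vertices] at h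
    have hd : ∃ c d : Fin j, readout n ((rot n ^ c.1) X.1) ≠ readout n ((rot n ^ d.1) X.1) := by
      by_contra! hc
      exact ne_zero_of_mem_sphere X.2.1
        (eq_zero_of_readout_const_of_fixed hj X.2.2 fun i => hc i ⟨0, hj⟩)
    obtain ⟨c, d, hcd⟩ := hd
    have him : a.im = 0 := by
      have h1 := congrArg Complex.im (h c)
      have h2 := congrArg Complex.im (h d)
      simp only [Complex.add_im, Complex.mul_im, Complex.ofReal_im, Complex.ofReal_re, mul_zero,
        zero_add] at h1 h2
      have : a.im * (readout n ((rot n ^ c.1) X.1) - readout n ((rot n ^ d.1) X.1)) = 0 := by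
        linarith
      exact (mul_eq_zero.1 this).resolve_right (sub_ne_zero.2 hcd)
    have hYX : Y.1 - a.re • X.1 = 0 := by
      refine eq_zero_of_readout_const_of_fixed hj (b := b.re) ?_ fun i => ?_
      · rw [map_sub, map_smul, X.2.2, Y.2.2]
      · have := congrArg Complex.re (h i)
        simp only [Complex.add_re, Complex.mul_re, Complex.ofReal_re, him, zero_mul,
          sub_zero] at this
        rw [map_sub, map_sub, map_smul, map_smul, this]
        simp
    have hY : Y.1 = a.re • X.1 := sub_eq_zero.1 hYX
    have hn := congrArg norm hY
    rw [norm_smul, mem_sphere_zero_iff_norm.1 X.2.1, mem_sphere_zero_iff_norm.1 Y.2.1, mul_one,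
      Real.norm_eq_abs] at hn
    rcases (abs_eq zero_le_one).1 hn.symm with h1 | h1
    · left; rw [hY, h1, one_smul]
    · right; rw [hY, h1]; simp
  · rintro (h | h)
    · exact ⟨1, 0, one_ne_zero, fun i => by simp [fixedPolygon, h]⟩
    · exact ⟨-1, 0, by simp, fun i => by simp [fixedPolygon, h, vertices]⟩

theorem finRotate_val {j : ℕ} (i : Fin j) : (finRotate j i).1 = (i.1 + 1) % j := by
  cases j with
  | zero => exact i.elim0
  | succ j => rw [finRotate_apply, Fin.val_add, Fin.val_one', Nat.add_mod_mod]

/-- Applying `𝓡ₙ` shifts the readouts by one place; the wrap-around at `j` is correct because `𝓡ₙʲ X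
= X`. -/
theorem shapeRelabel_fixedShape {j n : ℕ} (hj : 0 < j) (X : fixedPart j n)
    (h : rot n X.1 ∈ fixedPart j n) :
    shapeRelabel j (fixedShape hj X).1 = (fixedShape hj ⟨rot n X.1, h⟩).1 := by
  change shape j (relabel j _) = shape j _
  congr 1
  apply Subtype.ext
  funext i
  change vertices j n X.1 (finRotate j i) = vertices j n (rot n X.1) i
  simp only [vertices, finRotate_val]
  rw [rot_pow_mod X.2.2, pow_succ, LinearEquiv.mul_apply]

theorem orbitSpace_fixedPart_homeomorph {j n : ℕ} (hn : n ≠ 0) (hj : 0 < j) (hjn : j ∣ n) :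
    Nonempty (OrbitSpace (rotGroup n) (fixedPart j n) ≃ₜ UnlabelledShapes j) := by
  have hq : IsQuotientMap (fixedShape hj : fixedPart j n → _) :=
    (continuous_fixedShape hj).isClosedMap.isQuotientMap (continuous_fixedShape hj)
      (surjective_fixedShape hn hj hjn)
  refine nonempty_homeomorph_of_isQuotientMap (OrbitSpace.isQuotientMap_mk _ _)
    ((OrbitSpace.isQuotientMap_mk (Subgroup.zpowers (shapeRelabel j)) _).comp hq) fun X Y => ?_
  have key : ∀ i : ℤ, (shapeRelabel j ^ i) • (fixedShape hj Y).1 =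
      (fixedShape hj ⟨(rot n ^ i) Y.1, rot_zpow_mem_fixedPart i Y.2⟩).1 := fun i => by
    classical
    -- The intertwining lemma wants a map on the whole space; the value off the fixed part is
    -- arbitrary.
    let f : EuclideanSpace ℝ (Fin (n - 1)) → ShapeSpace j := fun X =>
      if h : X ∈ fixedPart j n then (fixedShape hj ⟨X, h⟩).1 else (fixedShape hj Y).1
    have hf : ∀ X (h : X ∈ fixedPart j n), f X = (fixedShape hj ⟨X, h⟩).1 := fun X h => dif_pos h
    have := (zpow_smul_semiconj (g := rot n) (h := shapeRelabel j) (f := f) (S := fixedPart j n)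
      (fun X => ⟨fun h => by
        have := rot_zpow_mem_fixedPart (-1) h
        rwa [LinearEquiv.smul_def, zpow_neg_one, ← LinearEquiv.mul_apply, inv_mul_cancel] at this,
        fun h => by simpa using rot_zpow_mem_fixedPart 1 h⟩)
      (fun X h => by
        have h' : rot n X ∈ fixedPart j n := by simpa using rot_zpow_mem_fixedPart 1 h
        rw [LinearEquiv.smul_def, hf _ h', hf _ h]
        exact (shapeRelabel_fixedShape hj ⟨X, h⟩ h').symm) i Y.1 Y.2)
    have h2 := this.2
    rw [LinearEquiv.smul_def, hf _ (rot_zpow_mem_fixedPart i Y.2), hf _ Y.2] at h2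
    exact h2.symm
  rw [orbitSpace_rotGroup_mk_eq, Function.comp, Function.comp, OrbitSpace.mk_eq_mk]
  simp only [Subgroup.exists_mem_zpowers, key, ← Subtype.ext_iff, fixedShape_eq_iff]
  refine exists_congr fun i => or_congr eq_comm ?_
  rw [eq_comm, neg_eq_iff_eq_neg]

end FixedPart


/-! ### Negated vectors: surviving blocks, and even `j` -/

section AntiPart

theorem zeta_pow_half {n a : ℕ} (ha : 0 < a) (hn : n = 2 * a) : zeta n ^ a = -1 := by
  have hζ := zeta_isPrimitiveRoot (n := n) (by omega)
  have h1 : zeta n ^ a * zeta n ^ a = 1 := by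
    rw [← pow_add, show a + a = n by omega, hζ.pow_eq_one]
  refine (mul_self_eq_one_iff.1 h1).resolve_left fun h => ?_
  have := Nat.le_of_dvd ha (hζ.dvd_of_pow_eq_one _ h)
  omega

/-- A nonzero coordinate forces `ζ^((m+1)j) = -1`. Squaring gives `c ∣ m + 1`, and an even quotient
would give `+1` instead. -/
theorem coord_eq_zero_of_anti {n c j m : ℕ} (hc : 0 < c) (hj : 0 < j) (hn : n = 2 * (c * j))
    {X : EuclideanSpace ℝ (Fin (n - 1))} (hX : (rot n ^ j) X = -X)
    (hm : ∀ t, m + 1 ≠ c * (2 * t + 1)) : coord m X = 0 := by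
  have hcj : 0 < c * j := Nat.mul_pos hc hj
  have hζ := zeta_isPrimitiveRoot (n := n) (by omega)
  by_contra h0
  have h := congrArg (coord m) hX
  rw [coord_rot_pow, coord_neg, ← neg_one_mul] at h
  have h1 : zeta n ^ ((m + 1) * j) = -1 := mul_right_cancel₀ h0 h
  have h2 : zeta n ^ ((m + 1) * j * 2) = 1 := by rw [pow_mul, h1]; norm_num
  have h3 := hζ.dvd_of_pow_eq_one _ h2
  have h4 : c ∣ m + 1 := by
    rw [hn, mul_comm 2 (c * j)] at h3
    exact Nat.dvd_of_mul_dvd_mul_right hj (Nat.dvd_of_mul_dvd_mul_right two_pos h3)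
  obtain ⟨s, hs⟩ := h4
  rcases Nat.even_or_odd' s with ⟨t, rfl | rfl⟩
  · have : (m + 1) * j = n * t := by rw [hs, hn]; ring
    rw [this, pow_mul, hζ.pow_eq_one, one_pow] at h1
    norm_num at h1
  · exact hm t hs

/-- The complex coordinates of the blocks of `𝓡ₙ` on which `𝓡ₙʲ` is `-1`. -/
noncomputable def antiProj (n c m : ℕ) :
    EuclideanSpace ℝ (Fin (n - 1)) →ₗ[ℝ] EuclideanSpace ℂ (Fin m) where
  toFun X := WithLp.toLp 2 fun t => coord (c * (2 * t.1 + 1) - 1) X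
  map_add' X Y := by ext t; simp [coord_add]
  map_smul' a X := by ext t; simp [coord_smul]

/-- The last coordinate of a vector, for `n = 2 c j`. -/
noncomputable def antiLast (n c j : ℕ) : EuclideanSpace ℝ (Fin (n - 1)) →ₗ[ℝ] ℝ where
  toFun X := (coord (c * j - 1) X).re
  map_add' X Y := by simp [coord_add]
  map_smul' a X := by simp [coord_smul]

theorem antiProj_apply {n c m : ℕ} (X : EuclideanSpace ℝ (Fin (n - 1))) (t : Fin m) :
    antiProj n c m X t = coord (c * (2 * t.1 + 1) - 1) X := rfl

theorem coord_last {n c j : ℕ} (hc : 0 < c) (hj : 0 < j) (hn : n = 2 * (c * j))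
    (X : EuclideanSpace ℝ (Fin (n - 1))) : coord (c * j - 1) X = antiLast n c j X := by
  have hcj : 0 < c * j := Nat.mul_pos hc hj
  apply Complex.ext
  · rfl
  · rw [coord_im_of_last (by omega)]; simp

/-- Among the `cj` blocks, those with `m + 1 = c(2t+1)` and `2t + 1 < j` number `j / 2`; the last,
real block `cj - 1` is split off separately. Applied to differences, this also gives injectivity of
the coordinates. -/
theorem norm_sq_of_anti {n c j m : ℕ} (hc : 0 < c) (hj : 0 < j) (hn : n = 2 * (c * j))
    (hm : m = j / 2) {X : EuclideanSpace ℝ (Fin (n - 1))} (hX : (rot n ^ j) X = -X) :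
    ‖X‖ ^ 2 = ‖antiProj n c m X‖ ^ 2 + antiLast n c j X ^ 2 := by
  have hcj : 0 < c * j := Nat.mul_pos hc hj
  rw [norm_sq_eq_sum_coord, show n / 2 = c * j - 1 + 1 by omega, Finset.sum_range_succ,
    coord_last hc hj hn, Complex.norm_real, Real.norm_eq_abs, sq_abs, EuclideanSpace.norm_sq_eq]
  congr 1
  symm
  refine Finset.sum_of_injOn (fun t : Fin m => c * (2 * t.1 + 1) - 1) ?_ ?_ ?_ fun t _ => rfl
  · intro t _ s _ h
    have h1 : 0 < c * (2 * t.1 + 1) := by positivity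
    have h2 : 0 < c * (2 * s.1 + 1) := by positivity
    have h3 : c * (2 * t.1 + 1) = c * (2 * s.1 + 1) := by
      simp only at h
      omega
    have := Nat.eq_of_mul_eq_mul_left hc h3
    exact Fin.ext (by omega)
  · intro t _
    have h1 : 0 < c * (2 * t.1 + 1) := by positivity
    have h2 : c * (2 * t.1 + 1) < c * j := Nat.mul_lt_mul_of_pos_left (by omega) hc
    simp only [Finset.coe_range, Set.mem_Iio]
    omega
  · intro i hi hit
    rw [coord_eq_zero_of_anti hc hj hn hX]
    · simp
    · intro t ht
      have hi := Finset.mem_range.1 hi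
      have h2 : c * (2 * t + 1) < c * j := by omega
      have h3 := Nat.lt_of_mul_lt_mul_left h2
      exact hit ⟨⟨t, by omega⟩, Finset.mem_coe.2 (Finset.mem_univ _), by simp only; omega⟩

theorem antiLast_eq_zero {n c j : ℕ} (hc : 0 < c) (hj : 0 < j) (hn : n = 2 * (c * j))
    (hje : Even j) {X : EuclideanSpace ℝ (Fin (n - 1))} (hX : (rot n ^ j) X = -X) :
    antiLast n c j X = 0 := by
  have hcj : 0 < c * j := Nat.mul_pos hc hj
  change (coord (c * j - 1) X).re = 0
  rw [coord_eq_zero_of_anti hc hj hn hX, Complex.zero_re]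
  intro t ht
  have : c * j = c * (2 * t + 1) := by omega
  have := Nat.eq_of_mul_eq_mul_left hc this
  obtain ⟨r, hr⟩ := hje
  omega

theorem eq_of_anti {n c j m : ℕ} (hc : 0 < c) (hj : 0 < j) (hn : n = 2 * (c * j))
    (hm : m = j / 2) {X Y : EuclideanSpace ℝ (Fin (n - 1))} (hX : (rot n ^ j) X = -X)
    (hY : (rot n ^ j) Y = -Y) (h1 : antiProj n c m X = antiProj n c m Y)
    (h2 : antiLast n c j X = antiLast n c j Y) : X = Y := by
  have h := norm_sq_of_anti hc hj hn hm (X := X - Y) (by rw [map_sub, hX, hY]; abel)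
  rw [map_sub, map_sub, h1, h2] at h
  simpa [sub_eq_zero] using h

theorem exists_anti {n c j m : ℕ} (hc : 0 < c) (hj : 0 < j) (hn : n = 2 * (c * j))
    (hm : m = j / 2) (z : EuclideanSpace ℂ (Fin m)) (x : ℝ) (hx : Even j → x = 0) :
    ∃ X : EuclideanSpace ℝ (Fin (n - 1)), (rot n ^ j) X = -X ∧ antiProj n c m X = z ∧
      antiLast n c j X = x := by
  classical
  have hcj : 0 < c * j := Nat.mul_pos hc hj
  have hlt : ∀ t : Fin m, 0 < c * (2 * t.1 + 1) ∧ c * (2 * t.1 + 1) < c * j := fun t =>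
    ⟨by positivity, Nat.mul_lt_mul_of_pos_left (by omega) hc⟩
  -- The chosen `t` is unique since `c > 0`, and never competes with the last block since `2t + 1 <
  -- j`.
  let d : ℕ → ℂ := fun l => if h : ∃ t : Fin m, l + 1 = c * (2 * t.1 + 1) then z h.choose
    else if l + 1 = c * j then x else 0
  have hd1 : ∀ t : Fin m, d (c * (2 * t.1 + 1) - 1) = z t := fun t => by
    have h : ∃ s : Fin m, c * (2 * t.1 + 1) - 1 + 1 = c * (2 * s.1 + 1) :=
      ⟨t, by have := hlt t; omega⟩
    simp only [d]
    rw [dif_pos h]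
    have h1 := h.choose_spec
    have h2 : c * (2 * t.1 + 1) = c * (2 * h.choose.1 + 1) := by have := hlt t; omega
    have := Nat.eq_of_mul_eq_mul_left hc h2
    have h3 : h.choose.1 = t.1 := by omega
    rw [show h.choose = t from Fin.ext h3]
  have hd2 : d (c * j - 1) = x := by
    simp only [d]
    rw [dif_neg, if_pos (by omega)]
    rintro ⟨t, ht⟩
    have := hlt t
    omega
  have hco : ∀ l < n / 2, coord l (ofCoord n d) = d l := fun l hl => by
    refine coord_ofCoord hl fun h => ?_
    rw [show l = c * j - 1 by omega, hd2, Complex.ofReal_im]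
  refine ⟨ofCoord n d, ?_, ?_, ?_⟩
  · refine coord_ext fun l hl => ?_
    rw [coord_rot_pow, coord_neg, hco l hl]
    have key : ∀ t, l + 1 = c * (2 * t + 1) → zeta n ^ ((l + 1) * j) = -1 := fun t ht => by
      rw [ht, show c * (2 * t + 1) * j = c * j * (2 * t + 1) by ring, pow_mul,
        zeta_pow_half hcj hn]
      exact Odd.neg_one_pow ⟨t, rfl⟩
    by_cases h1 : ∃ t : Fin m, l + 1 = c * (2 * t.1 + 1)
    · obtain ⟨t, ht⟩ := h1
      rw [key t ht, neg_one_mul]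
    · by_cases h2 : l + 1 = c * j
      · rcases Nat.even_or_odd' j with ⟨t, ht | ht⟩
        · have : d l = 0 := by
            simp only [d]
            rw [dif_neg h1, if_pos h2, hx ⟨t, by omega⟩]; simp
          rw [this]; simp
        · rw [key t (by rw [h2, ← ht]), neg_one_mul]
      · have : d l = 0 := by
          simp only [d]
          rw [dif_neg h1, if_neg h2]
        rw [this]; simp
  · ext t
    rw [antiProj_apply, hco _ (by have := hlt t; omega), hd1]
  · change (coord _ _).re = x
    rw [hco _ (by omega), hd2, Complex.ofReal_re]

theorem lensMap_apply {m : ℕ} (q : ℕ) (p : Fin m → ℤ) (z : EuclideanSpace ℂ (Fin m)) (t : Fin m) :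
    lensMap q p z t = Complex.exp (2 * Real.pi * Complex.I * (p t / q)) * z t := rfl

/-- The factor `c` cancels: `c(2t+1)/n = (2t+1)/(2j)`. This is the source of the odd weights. -/
theorem antiProj_rot {n c j m : ℕ} (hc : 0 < c) (hj : 0 < j) (hn : n = 2 * (c * j))
    (X : EuclideanSpace ℝ (Fin (n - 1))) :
    antiProj n c m (rot n X) = lensMap (2 * j) (oddWeights m) (antiProj n c m X) := by
  ext t
  have h1 : 0 < c * (2 * t.1 + 1) := by positivity
  rw [lensMap_apply, antiProj_apply, coord_rot, antiProj_apply, Nat.sub_add_cancel h1, zeta,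
    ← Complex.exp_nat_mul]
  congr 2
  have hn' : (n : ℂ) = 2 * (c * j) := by rw [hn]; push_cast; ring
  rw [hn']
  have hc' : (c : ℂ) ≠ 0 := Nat.cast_ne_zero.2 hc.ne'
  have hj' : (j : ℂ) ≠ 0 := Nat.cast_ne_zero.2 hj.ne'
  simp only [oddWeights]
  push_cast
  field_simp

theorem antiLast_rot {n c j : ℕ} (hc : 0 < c) (hj : 0 < j) (hn : n = 2 * (c * j))
    (X : EuclideanSpace ℝ (Fin (n - 1))) : antiLast n c j (rot n X) = -antiLast n c j X := by
  have hcj : 0 < c * j := Nat.mul_pos hc hj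
  change (coord _ _).re = -(coord _ _).re
  rw [coord_rot, Nat.sub_add_cancel hcj, zeta_pow_half hcj hn]
  simp

theorem lensMap_two_mul {m : ℕ} (j : ℕ) (p : Fin m → ℤ) (z : EuclideanSpace ℂ (Fin m)) :
    lensMap (2 * j) p (lensMap (2 * j) p z) = lensMap j p z := by
  ext t
  rw [lensMap_apply, lensMap_apply, lensMap_apply, ← mul_assoc, ← Complex.exp_add]
  congr 2
  push_cast
  ring

theorem norm_lensMap {m : ℕ} (q : ℕ) (p : Fin m → ℤ) (z : EuclideanSpace ℂ (Fin m)) :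
    ‖lensMap q p z‖ = ‖z‖ := by
  rw [EuclideanSpace.norm_eq, EuclideanSpace.norm_eq]
  congr 1
  refine Finset.sum_congr rfl fun t _ => ?_
  have : 2 * Real.pi * Complex.I * (p t / q) =
      ((2 * Real.pi * (p t / q) : ℝ) : ℂ) * Complex.I := by push_cast; ring
  rw [lensMap_apply, norm_mul, this, Complex.norm_exp_ofReal_mul_I, one_mul]

/-- The orbit relation of a lens space in terms of integral powers. -/
theorem lensSpace_mk_eq {m q : ℕ} {p : Fin m → ℤ}
    {z w : Metric.sphere (0 : EuclideanSpace ℂ (Fin m)) 1} :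
    OrbitSpace.mk (Subgroup.zpowers (lensMap q p)) z =
      OrbitSpace.mk (Subgroup.zpowers (lensMap q p)) w ↔
      ∃ i : ℤ, z.1 = (lensMap q p ^ i) w.1 := by
  rw [OrbitSpace.mk_eq_mk, Subgroup.exists_mem_zpowers]
  exact exists_congr fun i => eq_comm

theorem antiProj_rot_zpow {n c j m : ℕ} (hc : 0 < c) (hj : 0 < j) (hn : n = 2 * (c * j)) (i : ℤ)
    (X : EuclideanSpace ℝ (Fin (n - 1))) :
    antiProj n c m ((rot n ^ i) X) =
      (lensMap (2 * j) (oddWeights m) ^ i) (antiProj n c m X) :=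
  (zpow_smul_semiconj (g := rot n) (h := lensMap (2 * j) (oddWeights m)) (f := antiProj n c m)
    (S := Set.univ) (fun _ => by simp) (fun X _ => antiProj_rot hc hj hn X) i X trivial).2

theorem antiProj_rot_zpow_two_mul {n c j m : ℕ} (hc : 0 < c) (hj : 0 < j)
    (hn : n = 2 * (c * j)) (i : ℤ) (X : EuclideanSpace ℝ (Fin (n - 1))) :
    antiProj n c m ((rot n ^ (2 * i)) X) =
      (lensMap j (oddWeights m) ^ i) (antiProj n c m X) := by
  have := (zpow_smul_semiconj (g := rot n ^ 2) (h := lensMap j (oddWeights m))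
    (f := antiProj n c m) (S := Set.univ) (fun _ => by simp) (fun X _ => by
      rw [LinearEquiv.smul_def, pow_two, LinearEquiv.mul_apply, antiProj_rot hc hj hn,
        antiProj_rot hc hj hn, lensMap_two_mul]
      rfl) i X trivial).2
  rwa [← zpow_natCast, ← zpow_mul] at this

theorem antiLast_rot_zpow_two_mul {n c j : ℕ} (hc : 0 < c) (hj : 0 < j)
    (hn : n = 2 * (c * j)) (i : ℤ) (X : EuclideanSpace ℝ (Fin (n - 1))) :
    antiLast n c j ((rot n ^ (2 * i)) X) = antiLast n c j X := by
  have := (zpow_smul_semiconj (g := rot n ^ 2) (h := (1 : Equiv.Perm ℝ))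
    (f := antiLast n c j) (S := Set.univ) (fun _ => by simp) (fun X _ => by
      rw [LinearEquiv.smul_def, pow_two, LinearEquiv.mul_apply, antiLast_rot hc hj hn,
        antiLast_rot hc hj hn, neg_neg]
      rfl) i X trivial).2
  rwa [← zpow_natCast, ← zpow_mul, one_zpow, one_smul] at this

theorem continuous_antiProj (n c m : ℕ) : Continuous (antiProj n c m) :=
  (antiProj n c m).continuous_of_finiteDimensional

theorem continuous_antiLast (n c j : ℕ) : Continuous (antiLast n c j) :=
  (antiLast n c j).continuous_of_finiteDimensional

theorem rot_zpow_add_of_anti {n j : ℕ} {X : EuclideanSpace ℝ (Fin (n - 1))}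
    (hX : (rot n ^ j) X = -X) (i : ℤ) : (rot n ^ (i + j)) X = -(rot n ^ i) X := by
  rw [zpow_add, LinearEquiv.mul_apply, zpow_natCast, hX, map_neg]

/-- For even `j` the real coordinate vanishes, so the negated part is the sphere of `ℂᵐ`, and `ν`
adds nothing because it acts as `𝓡ₙʲ`. -/
theorem orbitSpace_antiPart_homeomorph_lensSpace {n c j m : ℕ} (hc : 0 < c) (hj : 0 < j)
    (hn : n = 2 * (c * j)) (hm : m = j / 2) (hje : Even j) :
    Nonempty (OrbitSpace (rotGroup n) (antiPart j n) ≃ₜ LensSpace (2 * j) (oddWeights m)) := by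
  have hnorm : ∀ X : EuclideanSpace ℝ (Fin (n - 1)), (rot n ^ j) X = -X →
      ‖antiProj n c m X‖ = ‖X‖ := fun X hX => by
    have h := norm_sq_of_anti hc hj hn hm hX
    rw [antiLast_eq_zero hc hj hn hje hX, zero_pow two_ne_zero, add_zero] at h
    exact ((sq_eq_sq₀ (norm_nonneg _) (norm_nonneg _)).1 h).symm
  let f : antiPart j n → Metric.sphere (0 : EuclideanSpace ℂ (Fin m)) 1 := fun X =>
    ⟨antiProj n c m X.1, by
      rw [mem_sphere_zero_iff_norm, hnorm _ X.2.2]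
      exact mem_sphere_zero_iff_norm.1 X.2.1⟩
  have hf : Continuous f := ((continuous_antiProj n c m).comp continuous_subtype_val).subtype_mk _
  have hs : Function.Surjective f := by
    rintro ⟨z, hz⟩
    obtain ⟨X, hX, h1, -⟩ := exists_anti hc hj hn hm z 0 fun _ => rfl
    refine ⟨⟨X, ?_, hX⟩, Subtype.ext h1⟩
    rw [mem_sphere_zero_iff_norm, ← hnorm X hX, h1]
    exact mem_sphere_zero_iff_norm.1 hz
  refine nonempty_homeomorph_of_isQuotientMap (OrbitSpace.isQuotientMap_mk _ _)
    ((OrbitSpace.isQuotientMap_mk (Subgroup.zpowers (lensMap (2 * j) (oddWeights m))) _).comp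
      (hf.isClosedMap.isQuotientMap hf hs)) fun X Y => ?_
  rw [orbitSpace_rotGroup_mk_eq, Function.comp, Function.comp, lensSpace_mk_eq]
  simp only [f, ← antiProj_rot_zpow hc hj hn]
  constructor
  · rintro ⟨i, h | h⟩
    · exact ⟨i, by rw [h]⟩
    · exact ⟨i + j, by rw [rot_zpow_add_of_anti Y.2.2, h]⟩
  · rintro ⟨i, h⟩
    have hY := (rot_zpow_mem_antiPart i Y.2).2
    refine ⟨i, Or.inl (eq_of_anti hc hj hn hm X.2.2 hY h ?_)⟩
    rw [antiLast_eq_zero hc hj hn hje X.2.2, antiLast_eq_zero hc hj hn hje hY]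

/-- An odd number `k` of sign changes would give `𝓡ₙⁿ X = -X`, whereas `𝓡ₙⁿ = 1`. -/
theorem antiPart_eq_empty {n j k : ℕ} (hn : n ≠ 0) (hk : n = j * k) (hko : Odd k) :
    antiPart j n = ∅ := by
  refine Set.eq_empty_of_forall_notMem fun X hX => ne_zero_of_mem_sphere hX.1 ?_
  have h : ∀ a : ℕ, (rot n ^ (j * (2 * a + 1))) X = -X := fun a => by
    induction a with
    | zero => simpa using hX.2
    | succ a ih =>
      rw [show j * (2 * (a + 1) + 1) = j + j + j * (2 * a + 1) by ring, pow_add,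
        LinearEquiv.mul_apply, ih, pow_add, LinearEquiv.mul_apply, map_neg, hX.2, map_neg, map_neg,
        hX.2, neg_neg]
  obtain ⟨a, rfl⟩ := hko
  have h1 := h a
  rw [← hk, rot_pow_self hn] at h1
  exact eq_zero_of_eq_neg h1

end AntiPart


/-! ### The cone over a lens space as a quotient of a cylinder -/

section ConeModBase

/-- The projection of `𝕊²ᵐ⁻¹ × [0, 1]`, together with the apex, onto the cone over the lens space
with antipodal points of the base identified. -/
noncomputable def coneProj {m : ℕ} (q : ℕ) (p : Fin m → ℤ) :
    (Metric.sphere (0 : EuclideanSpace ℂ (Fin m)) 1 × unitInterval) ⊕ Unit →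
      ConeModBase (lensNeg q p) :=
  fun w => Quot.mk _ (Quot.mk _
    (Sum.map (Prod.map (OrbitSpace.mk (Subgroup.zpowers (lensMap q p))) id) id w))

/-- A product of quotient maps need not be a quotient map; here the orbit map is open, so its
product with `[0, 1]` is. -/
theorem isQuotientMap_coneProj {m : ℕ} (q : ℕ) (p : Fin m → ℤ) :
    IsQuotientMap (coneProj q p) := by
  have hmem : ∀ g ∈ Subgroup.zpowers (lensMap q p),
      ∀ x ∈ Metric.sphere (0 : EuclideanSpace ℂ (Fin m)) 1, g • x ∈ Metric.sphere 0 1 := by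
    rintro _ ⟨i, rfl⟩ x hx
    refine (zpow_smul_semiconj (g := lensMap q p) (h := (1 : Equiv.Perm Unit))
      (f := fun _ => ()) (fun x => ?_) (fun _ _ => rfl) i x hx).1
    rw [LinearEquiv.smul_def, mem_sphere_zero_iff_norm, mem_sphere_zero_iff_norm, norm_lensMap]
  have hopen : IsOpenQuotientMap (OrbitSpace.mk (Subgroup.zpowers (lensMap q p)) :
      Metric.sphere (0 : EuclideanSpace ℂ (Fin m)) 1 → LensSpace q p) :=
    ⟨(OrbitSpace.isQuotientMap_mk _ _).surjective, (OrbitSpace.isQuotientMap_mk _ _).continuous,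
      OrbitSpace.isOpenMap_mk _
        (fun g _ => g.toLinearMap.continuous_of_finiteDimensional) hmem⟩
  have h1 := isQuotientMap_sumMap
    (hopen.prodMap (IsOpenQuotientMap.id (X := unitInterval))).isQuotientMap (IsQuotientMap.id (X := Unit))
  exact (isQuotientMap_quot_mk (r := BaseRel (lensNeg q p))).comp
    ((isQuotientMap_quot_mk (r := ConeRel (LensSpace q p))).comp h1)

theorem coneProj_apex {m : ℕ} (q : ℕ) (p : Fin m → ℤ)
    (z : Metric.sphere (0 : EuclideanSpace ℂ (Fin m)) 1) :
    coneProj q p (Sum.inl (z, 1)) = coneProj q p (Sum.inr ()) :=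
  congrArg (Quot.mk _) (Quot.sound (ConeRel.apex _))

theorem coneProj_base {m : ℕ} (q : ℕ) (p : Fin m → ℤ)
    (z : Metric.sphere (0 : EuclideanSpace ℂ (Fin m)) 1) :
    coneProj q p (Sum.inl (z, 0)) = coneProj q p (Sum.inl (-z, 0)) :=
  Quot.sound (BaseRel.base (τ := lensNeg q p) (OrbitSpace.mk _ z))

theorem coneProj_inl_congr {m : ℕ} {q : ℕ} {p : Fin m → ℤ}
    {z w : Metric.sphere (0 : EuclideanSpace ℂ (Fin m)) 1} {i : ℤ}
    (h : z.1 = (lensMap q p ^ i) w.1) (s : unitInterval) :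
    coneProj q p (Sum.inl (z, s)) = coneProj q p (Sum.inl (w, s)) := by
  have := lensSpace_mk_eq.2 ⟨i, h⟩
  simp only [coneProj, Sum.map_inl, Prod.map_apply, this]

/-- A map that respects the identifications of `coneProj` factors through it. -/
theorem exists_lift_coneProj {m : ℕ} {q : ℕ} {p : Fin m → ℤ} {Q : Type*}
    (a : (Metric.sphere (0 : EuclideanSpace ℂ (Fin m)) 1 × unitInterval) ⊕ Unit → Q)
    (hG : ∀ z w s (i : ℤ), z.1 = (lensMap q p ^ i) w.1 → a (Sum.inl (z, s)) = a (Sum.inl (w, s)))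
    (h1 : ∀ z, a (Sum.inl (z, 1)) = a (Sum.inr ()))
    (h0 : ∀ z, a (Sum.inl (z, 0)) = a (Sum.inl (-z, 0))) :
    ∃ β : ConeModBase (lensNeg q p) → Q, β ∘ coneProj q p = a := by
  let γ : (LensSpace q p × unitInterval) ⊕ Unit → Q :=
    Sum.elim (fun x => Quotient.lift (fun z => a (Sum.inl (z, x.2)))
      (fun z w h => by
        obtain ⟨i, hi⟩ := lensSpace_mk_eq.1
          (Quotient.sound h : OrbitSpace.mk _ z = OrbitSpace.mk _ w)
        exact hG z w x.2 i hi) x.1) fun _ => a (Sum.inr ())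
  let δ : Cone (LensSpace q p) → Q := Quot.lift γ (by
    rintro _ _ ⟨x⟩
    induction x using Quotient.inductionOn with | _ z
    exact h1 z)
  refine ⟨Quot.lift δ (by
    rintro _ _ ⟨x⟩
    induction x using Quotient.inductionOn with | _ z
    exact h0 z), ?_⟩
  funext w
  rcases w with ⟨z, s⟩ | ⟨⟩ <;> rfl

end ConeModBase

/-! ### Negated vectors for odd `j` -/

section AntiPartOdd

variable {n c j m : ℕ}

/-- Since `𝓡ₙʲ` is `-1` here and `j` is odd, an odd power of `𝓡ₙ` is minus an even one. Even powers
fix the real coordinate and act on the others by the lens map with `q = j`. -/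
theorem orbitSpace_antiPart_mk_eq (hc : 0 < c) (hj : 0 < j) (hn : n = 2 * (c * j))
    (hm : m = j / 2) (hjo : Odd j) {X Y : antiPart j n} :
    OrbitSpace.mk (rotGroup n) X = OrbitSpace.mk (rotGroup n) Y ↔ ∃ i : ℤ,
      (antiProj n c m X.1 = (lensMap j (oddWeights m) ^ i) (antiProj n c m Y.1) ∧
        antiLast n c j X.1 = antiLast n c j Y.1) ∨
      (antiProj n c m X.1 = -(lensMap j (oddWeights m) ^ i) (antiProj n c m Y.1) ∧
        antiLast n c j X.1 = -antiLast n c j Y.1) := by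
  rw [orbitSpace_rotGroup_mk_eq]
  have key : ∀ i : ℤ, (X.1 = (rot n ^ (2 * i)) Y.1 ∨ X.1 = -(rot n ^ (2 * i)) Y.1) ↔
      (antiProj n c m X.1 = (lensMap j (oddWeights m) ^ i) (antiProj n c m Y.1) ∧
        antiLast n c j X.1 = antiLast n c j Y.1) ∨
      (antiProj n c m X.1 = -(lensMap j (oddWeights m) ^ i) (antiProj n c m Y.1) ∧
        antiLast n c j X.1 = -antiLast n c j Y.1) := fun i => by
    have hY := rot_zpow_mem_antiPart (2 * i) Y.2
    rw [← antiProj_rot_zpow_two_mul hc hj hn, ← antiLast_rot_zpow_two_mul hc hj hn i Y.1,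
      ← map_neg (antiProj n c m), ← map_neg (antiLast n c j)]
    refine or_congr ⟨fun h => by rw [h]; exact ⟨rfl, rfl⟩, fun h => ?_⟩
      ⟨fun h => by rw [h]; exact ⟨rfl, rfl⟩, fun h => ?_⟩
    · exact eq_of_anti hc hj hn hm X.2.2 hY.2 h.1 h.2
    · exact eq_of_anti hc hj hn hm X.2.2 (neg_mem_antiPart hY).2 h.1 h.2
  simp only [← key]
  constructor
  · rintro ⟨i, h⟩
    rcases Int.even_or_odd' i with ⟨a, rfl | rfl⟩
    · exact ⟨a, h⟩
    · obtain ⟨r, hr⟩ := hjo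
      -- With `j = 2r + 1`, splitting off `𝓡ₙʲ` exchanges the two signs, hence the `h.symm` below.
      have e : (2 * a + 1 : ℤ) = 2 * (a - r) + (j : ℕ) := by rw [hr]; push_cast; ring
      rw [e, rot_zpow_add_of_anti Y.2.2, neg_neg] at h
      exact ⟨a - r, h.symm⟩
  · rintro ⟨i, h⟩
    exact ⟨2 * i, h⟩

/-- The part of `ℓʲ(n)` negated by `𝓡ₙʲ` is a sphere in `ℂᵐ × ℝ` when `j = 2m + 1`. -/
theorem exists_homeomorph_antiPart (hc : 0 < c) (hj : 0 < j) (hn : n = 2 * (c * j))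
    (hm : m = j / 2) (hjo : Odd j) :
    ∃ e : antiPart j n ≃ₜ {p : EuclideanSpace ℂ (Fin m) × ℝ | ‖p.1‖ ^ 2 + p.2 ^ 2 = 1},
      ∀ X, (e X).1 = (antiProj n c m X.1, antiLast n c j X.1) := by
  let f : antiPart j n → {p : EuclideanSpace ℂ (Fin m) × ℝ | ‖p.1‖ ^ 2 + p.2 ^ 2 = 1} :=
    fun X => ⟨(antiProj n c m X.1, antiLast n c j X.1), by
      change ‖antiProj n c m X.1‖ ^ 2 + antiLast n c j X.1 ^ 2 = 1
      rw [← norm_sq_of_anti hc hj hn hm X.2.2, mem_sphere_zero_iff_norm.1 X.2.1, one_pow]⟩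
  have hf : Continuous f := Continuous.subtype_mk
    (((continuous_antiProj n c m).comp continuous_subtype_val).prodMk
      ((continuous_antiLast n c j).comp continuous_subtype_val)) _
  have hb : Function.Bijective f := by
    constructor
    · intro X Y h
      have h' := Prod.ext_iff.1 (Subtype.ext_iff.1 h)
      exact Subtype.ext (eq_of_anti hc hj hn hm X.2.2 Y.2.2 h'.1 h'.2)
    · rintro ⟨⟨z, x⟩, h⟩
      obtain ⟨X, hX, h1, h2⟩ := exists_anti hc hj hn hm z x
        fun he => absurd hjo (Nat.not_odd_iff_even.2 he)
      refine ⟨⟨X, ?_, hX⟩, Subtype.ext (Prod.ext h1 h2)⟩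
      have h3 := norm_sq_of_anti hc hj hn hm hX
      rw [h1, h2] at h3
      have h4 : ‖X‖ ^ 2 = 1 := h3.trans h
      rw [mem_sphere_zero_iff_norm]
      exact (pow_eq_one_iff_of_nonneg (norm_nonneg X) two_ne_zero).1 h4
  exact ⟨Continuous.homeoOfEquivCompactToT2 (f := Equiv.ofBijective f hb) hf, fun X => rfl⟩

/-- The parametrization of the closed upper hemisphere of `ℂᵐ × ℝ` by a cylinder and its apex. -/
noncomputable def hemisphere (m : ℕ) :
    (Metric.sphere (0 : EuclideanSpace ℂ (Fin m)) 1 × unitInterval) ⊕ Unit →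
      {p : EuclideanSpace ℂ (Fin m) × ℝ | ‖p.1‖ ^ 2 + p.2 ^ 2 = 1} :=
  Sum.elim (fun w => ⟨(Real.sqrt (1 - w.2.1 ^ 2) • w.1.1, w.2.1), by
    have h0 : 0 ≤ 1 - w.2.1 ^ 2 := by have := w.2.2.1; have := w.2.2.2; nlinarith
    change ‖Real.sqrt (1 - w.2.1 ^ 2) • w.1.1‖ ^ 2 + w.2.1 ^ 2 = 1
    rw [norm_smul, mem_sphere_zero_iff_norm.1 w.1.2, mul_one, Real.norm_eq_abs, sq_abs,
      Real.sq_sqrt h0]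
    ring⟩) fun _ => ⟨(0, 1), by simp⟩

theorem continuous_hemisphere (m : ℕ) : Continuous (hemisphere m) := by
  refine Continuous.sumElim (Continuous.subtype_mk ?_ _) continuous_const
  have h2 : Continuous fun w : Metric.sphere (0 : EuclideanSpace ℂ (Fin m)) 1 × unitInterval =>
    w.2.1 := continuous_subtype_val.comp continuous_snd
  exact ((Real.continuous_sqrt.comp (continuous_const.sub (h2.pow 2))).smul
    (continuous_subtype_val.comp continuous_fst)).prodMk h2

theorem exists_hemisphere_eq {m : ℕ} {z : EuclideanSpace ℂ (Fin m)} {x : ℝ}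
    (h : ‖z‖ ^ 2 + x ^ 2 = 1) (hx : 0 ≤ x) : ∃ w, (hemisphere m w).1 = (z, x) := by
  -- At the pole there is no direction to normalize; the extra point covers it, and is the whole
  -- hemisphere when `m = 0`.
  by_cases hz : z = 0
  · refine ⟨Sum.inr (), ?_⟩
    subst hz
    have : x = 1 := by
      have h' : x ^ 2 = 1 := by simpa using h
      exact (pow_eq_one_iff_of_nonneg hx two_ne_zero).1 h'
    rw [this]; rfl
  · have hN : ‖z‖ ≠ 0 := norm_ne_zero_iff.2 hz
    refine ⟨Sum.inl (⟨‖z‖⁻¹ • z, ?_⟩, ⟨x, hx, ?_⟩), Prod.ext ?_ rfl⟩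
    · rw [mem_sphere_zero_iff_norm, norm_smul, norm_inv, norm_norm, inv_mul_cancel₀ hN]
    · nlinarith [sq_nonneg ‖z‖]
    · change Real.sqrt (1 - x ^ 2) • (‖z‖⁻¹ • z) = z
      rw [← h, add_sub_cancel_right, Real.sqrt_sq (norm_nonneg _), smul_smul, mul_inv_cancel₀ hN,
        one_smul]

/-- The hemisphere meets every orbit, and the orbit relation restricted to it consists of the lens
action at each height, the collapse at the pole and the antipodal gluing at height `0`. -/
theorem orbitSpace_antiPart_homeomorph_coneModBase (hc : 0 < c) (hj : 0 < j)
    (hn : n = 2 * (c * j)) (hm : m = j / 2) (hjo : Odd j) :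
    Nonempty (OrbitSpace (rotGroup n) (antiPart j n) ≃ₜ
      ConeModBase (lensNeg j (oddWeights m))) := by
  obtain ⟨e, he⟩ := exists_homeomorph_antiPart hc hj hn hm hjo
  let h : (Metric.sphere (0 : EuclideanSpace ℂ (Fin m)) 1 × unitInterval) ⊕ Unit → antiPart j n :=
    fun w => e.symm (hemisphere m w)
  have hcont : Continuous h := e.symm.continuous.comp (continuous_hemisphere m)
  have hval : ∀ w, (antiProj n c m (h w).1, antiLast n c j (h w).1) = (hemisphere m w).1 :=
    fun w => by rw [← he, e.apply_symm_apply]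
  have hP : ∀ w, antiProj n c m (h w).1 = (hemisphere m w).1.1 := fun w => by rw [← hval]
  have hL : ∀ w, antiLast n c j (h w).1 = (hemisphere m w).1.2 := fun w => by rw [← hval]
  let a := fun w => OrbitSpace.mk (rotGroup n) (h w)
  let neg : antiPart j n → antiPart j n := fun X => ⟨-X.1, neg_mem_antiPart X.2⟩
  have hneg : Continuous neg := continuous_subtype_val.neg.subtype_mk _
  -- The hemisphere and its image under `ν` cover the compact sphere, giving a quotient map from two
  -- copies. It factors through folding them together, because `ν` is in the group.
  have ha : IsQuotientMap a := by
    let r := Sum.elim h (neg ∘ h)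
    have hr : Continuous r := hcont.sumElim (hneg.comp hcont)
    have hrs : Function.Surjective r := by
      intro X
      have hX : ‖antiProj n c m X.1‖ ^ 2 + antiLast n c j X.1 ^ 2 = 1 := by
        rw [← norm_sq_of_anti hc hj hn hm X.2.2, mem_sphere_zero_iff_norm.1 X.2.1, one_pow]
      rcases le_total 0 (antiLast n c j X.1) with h0 | h0
      · obtain ⟨w, hw⟩ := exists_hemisphere_eq hX h0
        refine ⟨Sum.inl w, ?_⟩
        exact (e.symm_apply_eq).2 (Subtype.ext (hw.trans (he X).symm))
      · obtain ⟨w, hw⟩ := exists_hemisphere_eq (z := -antiProj n c m X.1)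
          (x := -antiLast n c j X.1) (by rw [norm_neg, neg_sq]; exact hX) (by linarith)
        refine ⟨Sum.inr w, ?_⟩
        have : h w = neg X := (e.symm_apply_eq).2 (Subtype.ext (hw.trans (by
          rw [he, ← map_neg, ← map_neg])))
        change neg (h w) = X
        rw [this]
        exact Subtype.ext (neg_neg X.1)
    have hq := (OrbitSpace.isQuotientMap_mk (rotGroup n) _).comp
      (hr.isClosedMap.isQuotientMap hr hrs)
    have hfold : OrbitSpace.mk (rotGroup n) ∘ r = a ∘ Sum.elim id id := by
      funext w
      rcases w with w | w
      · rfl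
      · refine orbitSpace_rotGroup_mk_eq.2 ⟨0, Or.inr ?_⟩
        simp [r, neg]
    rw [hfold] at hq
    exact hq.of_comp (continuous_id.sumElim continuous_id)
      ((OrbitSpace.isQuotientMap_mk _ _).continuous.comp hcont)
  have hiff := fun w w' =>
    orbitSpace_antiPart_mk_eq hc hj hn hm hjo (X := h w) (Y := h w')
  simp only [hP, hL] at hiff
  obtain ⟨β, hβ⟩ := exists_lift_coneProj (q := j) (p := oddWeights m) a
    (fun z w s i hzw => (hiff _ _).2 ⟨i, Or.inl ⟨by
      change Real.sqrt _ • z.1 = (lensMap j (oddWeights m) ^ i) (Real.sqrt _ • w.1)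
      rw [hzw]
      exact ((lensMap j (oddWeights m) ^ i).toLinearMap.map_smul_of_tower _ _).symm, rfl⟩⟩)
    (fun z => (hiff _ _).2 ⟨0, Or.inl ⟨by simp [hemisphere], rfl⟩⟩)
    (fun z => (hiff _ _).2 ⟨0, Or.inr ⟨by simp [hemisphere], by simp [hemisphere]⟩⟩)
  have hβq : IsQuotientMap β := by
    have hb := isQuotientMap_coneProj j (oddWeights m)
    rw [← hβ] at ha
    exact IsQuotientMap.of_comp hb.continuous (hb.continuous_iff.2 ha.continuous) ha
  -- Heights are nonnegative. With equal signs they agree, and below the apex the radius `√(1 - s²)`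
  -- can be cancelled; with opposite signs both are `0`, which is the gluing of the base.
  have hsphere : ∀ w w', a w = a w' →
      coneProj j (oddWeights m) w = coneProj j (oddWeights m) w' := by
    rintro (⟨z, s⟩ | ⟨⟩) (⟨w, t⟩ | ⟨⟩) h
    · have hs := s.2.1
      have ht := t.2.1
      obtain ⟨i, ⟨h1, h2⟩ | ⟨h1, h2⟩⟩ := (hiff _ _).1 h
      · obtain rfl : s = t := Subtype.ext h2
        by_cases hs1 : s = 1
        · rw [hs1, coneProj_apex, coneProj_apex]
        · have hlt : s.1 < 1 := lt_of_le_of_ne s.2.2 fun h => hs1 (Subtype.ext h)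
          have hr : Real.sqrt (1 - s.1 ^ 2) ≠ 0 := (Real.sqrt_pos.2 (by nlinarith)).ne'
          refine coneProj_inl_congr (i := i) (smul_right_injective _ hr ?_) s
          refine h1.trans ?_
          exact (lensMap j (oddWeights m) ^ i).toLinearMap.map_smul_of_tower _ _
      · change s.1 = -t.1 at h2
        obtain rfl : s = 0 := Subtype.ext (by change s.1 = 0; linarith)
        obtain rfl : t = 0 := Subtype.ext (by change t.1 = 0; linarith)
        rw [coneProj_base _ _ w]
        refine coneProj_inl_congr (i := i) ?_ 0
        rw [coe_neg_sphere, map_neg]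
        simpa [hemisphere] using h1
    · have hs := s.2.1
      obtain ⟨i, ⟨-, h2⟩ | ⟨-, h2⟩⟩ := (hiff _ _).1 h
      · obtain rfl : s = 1 := Subtype.ext h2
        rw [coneProj_apex]
      · change s.1 = -1 at h2
        linarith
    · have ht := t.2.1
      obtain ⟨i, ⟨-, h2⟩ | ⟨-, h2⟩⟩ := (hiff _ _).1 h
      · obtain rfl : t = 1 := Subtype.ext h2.symm
        rw [coneProj_apex]
      · change 1 = -t.1 at h2
        linarith
    · rfl
  have hinj : Function.Injective β := by
    intro x y hxy
    obtain ⟨w, rfl⟩ := (isQuotientMap_coneProj j (oddWeights m)).surjective x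
    obtain ⟨w', rfl⟩ := (isQuotientMap_coneProj j (oddWeights m)).surjective y
    exact hsphere w w' ((congrFun hβ w).symm.trans (hxy.trans (congrFun hβ w')))
  obtain ⟨E⟩ := nonempty_homeomorph_of_injective hβq hinj
  exact ⟨E.symm⟩

end AntiPartOdd

end NSegment

/-! ### Assembly of the three cases -/

theorem mainTheorem7 (n j k : ℕ) (hn : 3 ≤ n) (hj : 0 < j) (hjn : j < n) (hk : n = j * k) :
    (Odd k →
      Nonempty (NSegment.OrbitSpace (NSegment.rotGroup n) (NSegment.fixedLocus j n) ≃ₜ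
        NSegment.UnlabelledShapes j)) ∧
    (Even k → Even j →
      Nonempty (NSegment.OrbitSpace (NSegment.rotGroup n) (NSegment.fixedLocus j n) ≃ₜ
        NSegment.UnlabelledShapes j ⊕ NSegment.LensSpace (2 * j) (NSegment.oddWeights (j / 2)))) ∧
    (Even k → Odd j →
      Nonempty (NSegment.OrbitSpace (NSegment.rotGroup n) (NSegment.fixedLocus j n) ≃ₜ
        NSegment.UnlabelledShapes j ⊕
          NSegment.ConeModBase
            (NSegment.lensNeg j (NSegment.oddWeights ((j - 1) / 2))))) := by
  have hn0 : n ≠ 0 := by omega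
  obtain ⟨e⟩ := NSegment.orbitSpace_fixedLocus_homeomorph j n
  obtain ⟨f⟩ := NSegment.orbitSpace_fixedPart_homeomorph hn0 hj ⟨k, hk⟩
  have hhalf : Even k → ∃ c, 0 < c ∧ n = 2 * (c * j) := by
    rintro ⟨c, rfl⟩
    refine ⟨c, Nat.pos_of_ne_zero ?_, by rw [hk]; ring⟩
    rintro rfl
    simp at hk
    omega
  refine ⟨fun hko => ?_, fun hke hje => ?_, fun hke hjo => ?_⟩
  · have hempty : IsEmpty (NSegment.OrbitSpace (NSegment.rotGroup n) (NSegment.antiPart j n)) := by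
      refine ⟨fun x => ?_⟩
      induction x using Quotient.inductionOn with | _ X
      exact Set.eq_empty_iff_forall_notMem.1 (NSegment.antiPart_eq_empty hn0 hk hko) X.1 X.2
    exact ⟨(e.trans (Homeomorph.sumEmpty _ _)).trans f⟩
  · obtain ⟨c, hc, hcn⟩ := hhalf hke
    obtain ⟨g⟩ := NSegment.orbitSpace_antiPart_homeomorph_lensSpace hc hj hcn rfl hje
    exact ⟨e.trans (f.sumCongr g)⟩
  · obtain ⟨c, hc, hcn⟩ := hhalf hke
    have hm : (j - 1) / 2 = j / 2 := by
      obtain ⟨r, rfl⟩ := hjo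
      omega
    obtain ⟨g⟩ := NSegment.orbitSpace_antiPart_homeomorph_coneModBase hc hj hcn hm hjo
    exact ⟨e.trans (f.sumCongr g)⟩
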